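/- Let $f,h:[0,1]\to\mathbb R$ be twice continuously differentiable functions such that $f(1)<0<f(0)$, $h(1)=0$, $h'(1)\neq 0$ and $h(x)>0$ for $x\in[0,1)$, and fix $\beta\in(0,1/2)$. For $\varepsilon>0$ let $x^\varepsilon=(x^\varepsilon_t)_{t\ge 0}$, with values in $[0,1]$, be the solution of $$\varepsilon\,\dot x^\varepsilon_t=\varepsilon f(x^\varepsilon_t)+x^\varepsilon_t\,h(x^\varepsilon_t),\qquad x^\varepsilon_0=0 .$$ Let $(\sigma^\varepsilon_n)_{n\ge 1}$ be i.i.d. positive random variables with $\mathbb P(\sigma^\varepsilon_n>t)=\exp\big(-\varepsilon^{-1}\int_0^t h(x^\varepsilon_s)\,ds\big)$ for all $t>0$, let $\tau^\varepsilon_0=0$ and $\tau^\varepsilon_n=\sigma^\varepsilon_1+\dots+\sigma^\varepsilon_n$, and let $X^\varepsilon$ be the resetting process $X^\varepsilon_t=x^\varepsilon_{t-\tau^\varepsilon_n}$ for $t\in[\tau^\varepsilon_n,\tau^\varepsilon_{n+1})$, $n\ge 0$. Put $y^\varepsilon_*=1-\varepsilon^\beta$, $e^\varepsilon_0=0$ and,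 for $k\ge 0$, $$e^\varepsilon_{2k+1}=\inf\{t\ge e^\varepsilon_{2k}:\ X^\varepsilon_t>y^\varepsilon_*\},\qquad e^\varepsilon_{2k+2}=\inf\{t\ge e^\varepsilon_{2k+1}:\ X^\varepsilon_t=0\}\qquad(\inf\emptyset=\infty).$$ Then, for every $\varepsilon>0$, the process $$\bar X^\varepsilon_t=\sum_{k\ge 0}\mathbf 1_{t\in[e^\varepsilon_{2k+1},\,e^\varepsilon_{2k+2})},\qquad t\ge 0,$$ takes its values in $\{0,1\}$ and has almost surely càdlàg trajectories. As $\varepsilon\to 0^+$ it converges in law, in the space of càdlàg paths on $[0,\infty)$ equipped with Skorokhod's $J_1$ topology, to the continuous-time pure jump Markov process $(\bar X_t)_{t\ge 0}$ on $\{0,1\}$ that starts at $\bar X_0=0$ and jumps from $0$ to $1$ at rate $f(0)$ and from $1$ to $0$ at rate $-f(1)$. -/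

import Mathlib

open MeasureTheory ProbabilityTheory Filter Topology
open scoped NNReal ENNReal

noncomputable section

/-! ### Càdlàg paths and the Skorokhod space `D([0,∞), E)` -/

/-- A path `[0,∞) → E` is càdlàg: right-continuous with left limits. -/
def IsCadlag {E : Type*} [TopologicalSpace E] (g : ℝ≥0 → E) : Prop :=
  ∀ t, ContinuousWithinAt g (Set.Ici t) t ∧ ∃ l, Tendsto g (𝓝[<] t) (𝓝 l)

/-- The space `D([0,∞), E)` of càdlàg paths. -/
def SkorokhodSpace (E : Type*) [TopologicalSpace E] : Type _ := {g : ℝ≥0 → E // IsCadlag g}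

namespace SkorokhodSpace

/-- The basic `J₁`-neighbourhood of a path `g`: the paths that on `[0,T]` are `δ`-close to `g`,
after a time change (an increasing bijection of `[0,∞)`) which moves no time of `[0,T]` by more
than `δ`. -/
def nbhd {E : Type*} [MetricSpace E] (g : SkorokhodSpace E) (T : ℝ≥0) (δ : ℝ) :
    Set (SkorokhodSpace E) :=
  {g' | ∃ lam : ℝ≥0 ≃o ℝ≥0, ∀ t ≤ T, dist (lam t) t ≤ δ ∧ dist (g'.1 t) (g.1 (lam t)) ≤ δ}

theorem nbhd_mono {E : Type*} [MetricSpace E] (g : SkorokhodSpace E) {T T' : ℝ≥0} {δ δ' : ℝ}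
    (hT : T ≤ T') (hδ : δ' ≤ δ) : nbhd g T' δ' ⊆ nbhd g T δ := by
  rintro g' ⟨lam, h⟩
  exact ⟨lam, fun t ht => ⟨(h t (ht.trans hT)).1.trans hδ, (h t (ht.trans hT)).2.trans hδ⟩⟩

/-- Skorokhod's `J₁` topology on `D([0,∞), E)`: a sequence `gₙ` converges to `g` if and only if for
every `T` there are increasing bijections `λₙ` of `[0,∞)` with `sup_{t ≤ T} |λₙ(t) - t| → 0` and
`sup_{t ≤ T} d(gₙ(t), g(λₙ(t))) → 0`. -/
instance {E : Type*} [MetricSpace E] : TopologicalSpace (SkorokhodSpace E) where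
  IsOpen U := ∀ g ∈ U, ∃ T : ℝ≥0, ∃ δ : ℝ, 0 < δ ∧ nbhd g T δ ⊆ U
  isOpen_univ := fun _ _ => ⟨0, 1, one_pos, Set.subset_univ _⟩
  isOpen_inter := by
    rintro U V hU hV g ⟨hgU, hgV⟩
    obtain ⟨T, δ, hδ, h⟩ := hU g hgU
    obtain ⟨T', δ', hδ', h'⟩ := hV g hgV
    exact ⟨max T T', min δ δ', lt_min hδ hδ', fun g' hg' =>
      ⟨h (nbhd_mono g (le_max_left _ _) (min_le_left _ _) hg'),
        h' (nbhd_mono g (le_max_right _ _) (min_le_right _ _) hg')⟩⟩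
  isOpen_sUnion := by
    rintro S hS g ⟨U, hU, hg⟩
    obtain ⟨T, δ, hδ, h⟩ := hS U hU g hg
    exact ⟨T, δ, hδ, h.trans (Set.subset_sUnion_of_mem hU)⟩

/-- The Borel `σ`-algebra of the `J₁` topology. -/
instance {E : Type*} [MetricSpace E] : MeasurableSpace (SkorokhodSpace E) := borel _

instance {E : Type*} [MetricSpace E] : BorelSpace (SkorokhodSpace E) := ⟨rfl⟩

open Classical in
/-- A càdlàg path seen as a point of `D([0,∞), ℕ)`. The value at a path that is not càdlàg (the
zero path) plays no role: the processes below are almost surely càdlàg. -/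
def ofPath (g : ℝ≥0 → ℕ) : SkorokhodSpace ℕ :=
  if hg : IsCadlag g then ⟨g, hg⟩
  else ⟨fun _ => 0, fun _ => ⟨continuousWithinAt_const, 0, tendsto_const_nhds⟩⟩

end SkorokhodSpace

/-! ### The resetting dynamics -/

/-- The assumptions on the coefficients: `f, h` are `C²` on `[0,1]` (with one-sided derivatives at
the end points), `f 1 < 0 < f 0`, `h 1 = 0`, `h' 1 ≠ 0` and `h > 0` on `[0,1)`. -/
structure IsResettingPair (f h : ℝ → ℝ) : Prop where
  contDiffOn_f : ContDiffOn ℝ 2 f (Set.Icc 0 1)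
  contDiffOn_h : ContDiffOn ℝ 2 h (Set.Icc 0 1)
  f_one_neg : f 1 < 0
  f_zero_pos : 0 < f 0
  h_one : h 1 = 0
  deriv_h_one : derivWithin h (Set.Icc 0 1) 1 ≠ 0
  h_pos : ∀ x ∈ Set.Ico (0 : ℝ) 1, 0 < h x

/-- `x : [0,∞) → [0,1]` solves `ε ẋ = ε f(x) + x h(x)`, `x 0 = 0`. -/
structure IsFlow (f h : ℝ → ℝ) (ε : ℝ) (x : ℝ → ℝ) : Prop where
  init : x 0 = 0
  mem_Icc : ∀ t, 0 ≤ t → x t ∈ Set.Icc (0 : ℝ) 1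
  ode : ∀ t, 0 ≤ t →
    HasDerivWithinAt x (ε⁻¹ * (ε * f (x t) + x t * h (x t))) (Set.Ici 0) t

/-- `σ 0, σ 1, …` are i.i.d. positive random variables with
`P(σ n > t) = exp(-ε⁻¹ ∫₀ᵗ h(x s) ds)` for `t > 0`. -/
structure IsResetGaps (h : ℝ → ℝ) (ε : ℝ) (x : ℝ → ℝ) {Ω : Type*} [MeasurableSpace Ω]
    (P : Measure Ω) (σ : ℕ → Ω → ℝ) : Prop where
  measurable : ∀ n, Measurable (σ n)
  pos : ∀ n ω, 0 < σ n ω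
  indep : iIndepFun σ P
  tail : ∀ n, ∀ t : ℝ, 0 < t →
    P {ω | t < σ n ω} = ENNReal.ofReal (Real.exp (-(ε⁻¹ * ∫ s in (0 : ℝ)..t, h (x s))))

/-- The partial sums `s 0 + … + s (n - 1)` of a sequence of durations. -/
def partialTime (s : ℕ → ℝ) (n : ℕ) : ℝ := ∑ i ∈ Finset.range n, s i

/-- The last reset time before or at time `t`, when the gaps between resets are `s 0, s 1, …`:
it equals `partialTime s n` if `partialTime s n ≤ t < partialTime s (n + 1)`. -/
def lastReset (s : ℕ → ℝ) (t : ℝ) : ℝ := sSup {r | (∃ n, partialTime s n = r) ∧ r ≤ t}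

/-- The resetting path: it follows the flow `x`, restarted from `x 0 = 0` at each reset time. -/
def resettingPath (x : ℝ → ℝ) (s : ℕ → ℝ) (t : ℝ≥0) : ℝ := x (t - lastReset s t)

/-- The times `e 0 = 0`, `e (2k+1) = inf {t ≥ e (2k) | X t > y}` and
`e (2k+2) = inf {t ≥ e (2k+1) | X t = 0}` of a path `X`, with `inf ∅ = ∞`. -/
def switchTime (X : ℝ≥0 → ℝ) (y : ℝ) : ℕ → ℝ≥0∞
  | 0 => 0
  | n + 1 => sInf {r : ℝ≥0∞ | ∃ t : ℝ≥0, r = t ∧ switchTime X y n ≤ t ∧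
      if Even n then y < X t else X t = 0}

/-- The path `t ↦ ∑ₖ 1{t ∈ [e (2k+1), e (2k+2))}`. -/
def switchPath (X : ℝ≥0 → ℝ) (y : ℝ) (t : ℝ≥0) : ℕ :=
  ∑' k : ℕ, Set.indicator
    (Set.Ico (switchTime X y (2 * k + 1)) (switchTime X y (2 * k + 2))) (fun _ => 1) (t : ℝ≥0∞)

/-! ### The limit -/

/-- `X` is the (pure jump) Markov process on `{0,1}` started at `0` that jumps from `0` to `1` at
rate `a` and from `1` to `0` at rate `b`, in the standard description by its jump chain and its
holding times: it visits `0, 1, 0, 1, …` in turn, and the successive holding times are independent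
and exponential, of parameter `a` in the state `0` and of parameter `b` in the state `1`. -/
def IsTwoStateJumpMarkov (a b : ℝ) {Ω : Type*} [MeasurableSpace Ω] (P : Measure Ω)
    (X : Ω → ℝ≥0 → ℕ) : Prop :=
  ∃ S : ℕ → Ω → ℝ, (∀ n, Measurable (S n)) ∧ iIndepFun S P ∧
    (∀ n, P.map (S n) = expMeasure (if Even n then a else b)) ∧
    ∀ᵐ ω ∂P, ∀ (n : ℕ) (t : ℝ≥0), partialTime (fun i => S i ω) n ≤ t →
      (t : ℝ) < partialTime (fun i => S i ω) (n + 1) → X ω t = if Even n then 0 else 1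

end

/-! The switching path is a deterministic function of its successive sojourn times below and above
the level `y = 1 - ε ^ β`. If the flow crosses `y` at time `a`, the resetting process is above `y`
exactly when its age (time since the last reset) exceeds `a`. Hence a sojourn below lasts for the
sum of the gaps that are at most `a`, plus `a`; the sojourn above that follows is the excess over
`a` of the first longer gap; then everything starts afresh. An alternating path depends
`J₁`-continuously on its holding times (`continuousOn_ofPath_altPath`), so by continuous mapping it
is enough that the sojourns converge in law, as random sequences, to independent exponential
variables.

This is done with characteristic functions. Conditioning on the first gap gives a linear recursion
(`sojournChar_succ_eq_add`). Writing `G` for the survival function of a gap, its solution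
(`sojournChar_succ_eq_mul`) multiplies, for each pair of sojourns, by the two factors `1 / (1 - iξ₀
∫₀ᵃ e^{iξ₀(t-a)} G(t)/G(a) dt)` and `1 + iξ₁ ∫₀^∞ e^{iξ₁t} G(a+t)/G(a) dt`. It remains to see that
`a → 0`, that `∫₀ᵃ G/G(a) → 1/f(0)`, and that `G(a+t)/G(a) → e^{f(1)t}` with an integrable bound.

The last two limits rest on one identity, `(xG)' = f(x) G`: the terms in `h/ε` of the flow and of
the survival function cancel. Over `[0,a]` it gives `x(a) G(a) = ∫₀ᵃ f(x) G`; the mass of `G` there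
sits where `x` is small, so the right side is close to `f(0) ∫₀ᵃ G`, while `x(a) → 1`. After time
`a`, `x` stays close to `1`, so `xG`, and with it `G`, decays at a rate close to `-f(1)`.

Finally `a = O(√ε)`: the drift `f` carries the flow from `0` to `√ε`, and the fast term `x h(x)/ε`
carries it from there to `1 - ε ^ β`. -/

/-! ### Alternating paths with prescribed holding times -/

/-- A sequence of positive durations with infinite sum. -/
def IsHoldingSeq (d : ℕ → ℝ) : Prop :=
  (∀ n, 0 < d n) ∧ Tendsto (partialTime d) atTop atTop

open Classical in
/-- The path on `{0,1}` which visits `0, 1, 0, 1, …` in turn, with holding times `d 0, d 1, …`. -/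
noncomputable def altPath (d : ℕ → ℝ) (t : ℝ≥0) : ℕ :=
  if ∃ k, partialTime d (2 * k + 1) ≤ t ∧ (t : ℝ) < partialTime d (2 * k + 2) then 1 else 0

theorem partialTime_zero (d : ℕ → ℝ) : partialTime d 0 = 0 := by simp [partialTime]

theorem partialTime_succ (d : ℕ → ℝ) (n : ℕ) :
    partialTime d (n + 1) = partialTime d n + d n := by
  simp [partialTime, Finset.sum_range_succ]

theorem partialTime_strictMono {d : ℕ → ℝ} (hd : ∀ n, 0 < d n) : StrictMono (partialTime d) :=
  strictMono_nat_of_lt_succ fun n => by rw [partialTime_succ]; linarith [hd n]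

theorem partialTime_nonneg {d : ℕ → ℝ} (hd : ∀ n, 0 < d n) (n : ℕ) : 0 ≤ partialTime d n :=
  Finset.sum_nonneg fun i _ => (hd i).le

theorem partialTime_add (d : ℕ → ℝ) (m n : ℕ) :
    partialTime d (m + n) = partialTime d m + partialTime (fun i => d (m + i)) n := by
  simp [partialTime, Finset.sum_range_add]

theorem partialTime_index_unique {d : ℕ → ℝ} (hd : ∀ n, 0 < d n) {m n : ℕ} {t : ℝ}
    (hm : partialTime d m ≤ t) (hm' : t < partialTime d (m + 1))
    (hn : partialTime d n ≤ t) (hn' : t < partialTime d (n + 1)) : m = n := by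
  have h := partialTime_strictMono hd
  have h1 := h.lt_iff_lt.1 (hm.trans_lt hn')
  have h2 := h.lt_iff_lt.1 (hn.trans_lt hm')
  omega

namespace IsHoldingSeq

variable {d : ℕ → ℝ}

theorem exists_index (hd : IsHoldingSeq d) {t : ℝ} (ht : 0 ≤ t) :
    ∃ n, partialTime d n ≤ t ∧ t < partialTime d (n + 1) := by
  have hex : ∃ n, t < partialTime d n := (hd.2.eventually_gt_atTop t).exists
  classical
  have hpos : Nat.find hex ≠ 0 := fun h0 => by
    have := Nat.find_spec hex
    rw [h0, partialTime_zero] at this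
    exact absurd ht (not_le.2 this)
  obtain ⟨n, hn⟩ := Nat.exists_eq_succ_of_ne_zero hpos
  refine ⟨n, not_lt.1 (Nat.find_min hex (by omega)), ?_⟩
  have := Nat.find_spec hex
  rwa [hn] at this

theorem altPath_eq (hd : ∀ n, 0 < d n) {n : ℕ} {t : ℝ≥0} (h : partialTime d n ≤ t)
    (h' : (t : ℝ) < partialTime d (n + 1)) : altPath d t = if Even n then 0 else 1 := by
  unfold altPath
  split_ifs with h1 h2 h2
  · obtain ⟨k, hk, hk'⟩ := h1
    have := partialTime_index_unique hd h h' hk hk'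
    exact absurd h2 (by rw [this]; simp)
  · rfl
  · rfl
  · exfalso
    obtain ⟨k, hk⟩ := Nat.not_even_iff_odd.1 h2
    subst hk
    exact h1 ⟨k, h, h'⟩

theorem altPath_congr {d' : ℕ → ℝ} (hd : ∀ n, 0 < d n) (hd' : ∀ n, 0 < d' n) {n : ℕ} {t t' : ℝ≥0}
    (h : partialTime d n ≤ t) (h' : (t : ℝ) < partialTime d (n + 1))
    (h2 : partialTime d' n ≤ t') (h2' : (t' : ℝ) < partialTime d' (n + 1)) :
    altPath d t = altPath d' t' := by
  rw [altPath_eq hd h h', altPath_eq hd' h2 h2']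

theorem isCadlag_altPath (hd : IsHoldingSeq d) : IsCadlag (altPath d) := by
  intro t
  obtain ⟨n, hn, hn'⟩ := hd.exists_index (NNReal.coe_nonneg t)
  constructor
  · have hev : ∀ᶠ s in 𝓝[≥] t, altPath d s = altPath d t := by
      have h1 : ∀ᶠ s : ℝ≥0 in 𝓝 t, (s : ℝ) < partialTime d (n + 1) :=
        (NNReal.continuous_coe.tendsto t).eventually_lt_const hn'
      filter_upwards [nhdsWithin_le_nhds h1, self_mem_nhdsWithin] with s hs hts
      exact altPath_congr hd.1 hd.1 (hn.trans (by exact_mod_cast hts)) hs hn hn'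
    exact (tendsto_const_nhds.congr' (hev.mono fun s hs => hs.symm))
  · rcases eq_or_lt_of_le hn with heq | hlt
    · rcases n with _ | m
      · have : t = 0 := by
          rw [partialTime_zero] at heq
          exact_mod_cast heq.symm
        subst this
        -- There is nothing to the left of `0` in `ℝ≥0`, so every value is a left limit there.
        exact ⟨0, by simp⟩
      · refine ⟨if Even m then 0 else 1, tendsto_const_nhds.congr' ?_⟩
        have h1 : ∀ᶠ s : ℝ≥0 in 𝓝 t, partialTime d m < (s : ℝ) := by
          refine (NNReal.continuous_coe.tendsto t).eventually_const_lt ?_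
          rw [← heq]
          exact partialTime_strictMono hd.1 m.lt_succ_self
        filter_upwards [nhdsWithin_le_nhds h1, self_mem_nhdsWithin] with s hs hts
        refine (altPath_eq hd.1 hs.le ?_).symm
        rw [heq]
        exact_mod_cast hts
    · refine ⟨if Even n then 0 else 1, tendsto_const_nhds.congr' ?_⟩
      have h1 : ∀ᶠ s : ℝ≥0 in 𝓝 t, partialTime d n < (s : ℝ) :=
        (NNReal.continuous_coe.tendsto t).eventually_const_lt hlt
      filter_upwards [nhdsWithin_le_nhds h1, self_mem_nhdsWithin] with s hs hts
      refine (altPath_eq hd.1 hs.le (lt_of_lt_of_le ?_ hn'.le)).symm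
      exact_mod_cast hts

end IsHoldingSeq

/-! ### Piecewise linear time changes -/

/-- The piecewise linear function that maps each interval of length `d' k` of the partition with
durations `d'` onto the corresponding interval of length `d k`, for `k < N`, and is a translation
afterwards. -/
noncomputable def pwLinear (d d' : ℕ → ℝ) (N : ℕ) (t : ℝ) : ℝ :=
  ∑ k ∈ Finset.range N, min (max (t - partialTime d' k) 0) (d' k) * (d k / d' k) +
    max (t - partialTime d' N) 0

/-- The clamped terms are the lengths of the portions of `[0, t]` in the successive intervals of the
partition; with the remainder past the last one they add up to `t`. -/
theorem sum_clamp_add {d' : ℕ → ℝ} (hd' : ∀ n, 0 < d' n) (N : ℕ) {t : ℝ} (ht : 0 ≤ t) :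
    ∑ k ∈ Finset.range N, min (max (t - partialTime d' k) 0) (d' k) +
      max (t - partialTime d' N) 0 = t := by
  induction N with
  | zero => simp [partialTime_zero, ht]
  | succ n ih =>
    rw [Finset.sum_range_succ, partialTime_succ]
    have := hd' n
    have key : min (max (t - partialTime d' n) 0) (d' n) + max (t - (partialTime d' n + d' n)) 0
        = max (t - partialTime d' n) 0 := by
      rcases le_total (t - partialTime d' n) 0 with h | h
      · rw [max_eq_right h, max_eq_right (by linarith), min_eq_left this.le, add_zero]
      · rw [max_eq_left h]
        rcases le_total (t - partialTime d' n) (d' n) with h2 | h2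
        · rw [min_eq_left h2, max_eq_right (by linarith), add_zero]
        · rw [min_eq_right h2, max_eq_left (by linarith)]; ring
    linarith

theorem continuous_pwLinear (d d' : ℕ → ℝ) (N : ℕ) : Continuous (pwLinear d d' N) := by
  unfold pwLinear
  fun_prop

/-- The clamped lengths are monotone in time and by `sum_clamp_add` they add up to the time itself,
so at least one increases strictly; positive slopes preserve this. -/
theorem pwLinear_strictMonoOn {d d' : ℕ → ℝ} (hd : ∀ n, 0 < d n) (hd' : ∀ n, 0 < d' n) (N : ℕ) :
    StrictMonoOn (pwLinear d d' N) (Set.Ici 0) := by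
  intro s hs t ht hst
  have hpos : ∀ k, 0 < d k / d' k := fun k => div_pos (hd k) (hd' k)
  have hmono : ∀ k, min (max (s - partialTime d' k) 0) (d' k)
      ≤ min (max (t - partialTime d' k) 0) (d' k) := fun k => by gcongr
  have hmono' : max (s - partialTime d' N) 0 ≤ max (t - partialTime d' N) 0 := by gcongr
  have hmul : ∀ k ∈ Finset.range N, min (max (s - partialTime d' k) 0) (d' k) * (d k / d' k)
      ≤ min (max (t - partialTime d' k) 0) (d' k) * (d k / d' k) := fun k _ =>
    mul_le_mul_of_nonneg_right (hmono k) (hpos k).le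
  have hlt := hst
  rw [← sum_clamp_add hd' N hs, ← sum_clamp_add hd' N ht] at hlt
  unfold pwLinear
  rcases lt_or_ge (max (s - partialTime d' N) 0) (max (t - partialTime d' N) 0) with h | h
  · exact add_lt_add_of_le_of_lt (Finset.sum_le_sum hmul) h
  · have h2 : ∑ k ∈ Finset.range N, min (max (s - partialTime d' k) 0) (d' k)
      < ∑ k ∈ Finset.range N, min (max (t - partialTime d' k) 0) (d' k) := by linarith
    obtain ⟨k, hk, hk'⟩ := Finset.exists_lt_of_sum_lt h2
    refine add_lt_add_of_lt_of_le (Finset.sum_lt_sum hmul ⟨k, hk, ?_⟩) hmono'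
    exact mul_lt_mul_of_pos_right hk' (hpos k)

theorem pwLinear_partialTime {d d' : ℕ → ℝ} (hd' : ∀ n, 0 < d' n) {N j : ℕ}
    (hj : j ≤ N) : pwLinear d d' N (partialTime d' j) = partialTime d j := by
  have hm := (partialTime_strictMono hd').monotone
  unfold pwLinear
  rw [max_eq_right (by linarith [hm hj]), add_zero]
  have h1 : ∀ k ∈ Finset.range N,
      min (max (partialTime d' j - partialTime d' k) 0) (d' k) * (d k / d' k)
        = if k ∈ Finset.range j then d k else 0 := by
    intro k _
    have hk := hd' k
    split_ifs with h
    · have : partialTime d' (k + 1) ≤ partialTime d' j := hm (Finset.mem_range.1 h)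
      rw [partialTime_succ] at this
      rw [max_eq_left (by linarith), min_eq_right (by linarith)]
      field_simp
    · have : partialTime d' j ≤ partialTime d' k := hm (not_lt.1 (mt Finset.mem_range.2 h))
      rw [max_eq_right (by linarith), min_eq_left hk.le, zero_mul]
  rw [Finset.sum_congr rfl h1, Finset.sum_ite_mem, partialTime]
  congr 1
  ext k
  simp only [Finset.mem_inter, Finset.mem_range]
  omega

theorem abs_pwLinear_sub_le {d d' : ℕ → ℝ} (hd' : ∀ n, 0 < d' n) (N : ℕ) {t : ℝ} (ht : 0 ≤ t) :
    |pwLinear d d' N t - t| ≤ ∑ k ∈ Finset.range N, |d k - d' k| := by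
  have h1 : pwLinear d d' N t - t =
      ∑ k ∈ Finset.range N, min (max (t - partialTime d' k) 0) (d' k) * (d k / d' k - 1) := by
    conv_lhs => rw [← sum_clamp_add hd' N ht]
    rw [sum_clamp_add hd' N ht]
    unfold pwLinear
    simp only [mul_sub, mul_one, Finset.sum_sub_distrib]
    linarith [sum_clamp_add hd' N ht]
  rw [h1]
  refine (Finset.abs_sum_le_sum_abs _ _).trans (Finset.sum_le_sum fun k _ => ?_)
  have hk := hd' k
  have h0 : 0 ≤ min (max (t - partialTime d' k) 0) (d' k) := le_min (le_max_right _ _) hk.le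
  rw [abs_mul, abs_of_nonneg h0]
  calc _ ≤ d' k * |d k / d' k - 1| := by gcongr; exact min_le_right _ _
    _ = |d k - d' k| := by
      rw [← abs_of_pos hk, ← abs_mul, abs_of_pos hk]
      congr 1
      field_simp

/-- This is the time change of the `J₁` topology. It sends holding interval onto holding interval,
so after it two alternating paths agree exactly and only the displacement of time has to be
controlled. -/
theorem exists_orderIso_partialTime {d d' : ℕ → ℝ} (hd : ∀ n, 0 < d n) (hd' : ∀ n, 0 < d' n)
    (N : ℕ) : ∃ lam : ℝ≥0 ≃o ℝ≥0,
      (∀ t, dist (lam t) t ≤ ∑ k ∈ Finset.range N, |d k - d' k|) ∧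
      ∀ n < N, ∀ t : ℝ≥0, partialTime d' n ≤ t → (t : ℝ) < partialTime d' (n + 1) →
        partialTime d n ≤ lam t ∧ (lam t : ℝ) < partialTime d (n + 1) := by
  have hmono := pwLinear_strictMonoOn hd hd' N
  have hzero : pwLinear d d' N 0 = 0 := by
    have := pwLinear_partialTime (d := d) hd' (Nat.zero_le N)
    rwa [partialTime_zero, partialTime_zero] at this
  have hnn : ∀ t : ℝ≥0, 0 ≤ pwLinear d d' N t := fun t => by
    rw [← hzero]
    exact hmono.monotoneOn (Set.mem_Ici.2 le_rfl) t.2 t.2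
  let g : ℝ≥0 → ℝ≥0 := fun t => ⟨pwLinear d d' N t, hnn t⟩
  have hg : StrictMono g := fun s t hst => by
    change pwLinear d d' N s < pwLinear d d' N t
    exact hmono s.2 t.2 (by exact_mod_cast hst)
  have hsurj : Function.Surjective g := by
    intro v
    set C := ∑ k ∈ Finset.range N, |d k - d' k| with hC
    have hC0 : 0 ≤ C := Finset.sum_nonneg fun _ _ => abs_nonneg _
    -- No time moves by more than `C`, so the value at `v + C` is at least `v`, and the intermediate
    -- value theorem applies on `[0, v + C]`.
    have hb : (0 : ℝ) ≤ v + C := add_nonneg v.2 hC0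
    have h1 := abs_pwLinear_sub_le (d := d) hd' N hb
    have h2 : (v : ℝ) ≤ pwLinear d d' N (v + C) := by
      have := (abs_le.1 h1).1
      linarith
    obtain ⟨u, hu, huv⟩ := intermediate_value_Icc hb (continuous_pwLinear d d' N).continuousOn
      (show (v : ℝ) ∈ Set.Icc _ _ from ⟨by rw [hzero]; exact v.2, h2⟩)
    exact ⟨⟨u, hu.1⟩, NNReal.eq huv⟩
  refine ⟨hg.orderIsoOfSurjective g hsurj, fun t => ?_, fun n hn t h1 h2 => ?_⟩
  · exact abs_pwLinear_sub_le hd' N t.2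
  · change partialTime d n ≤ pwLinear d d' N t ∧ pwLinear d d' N t < partialTime d (n + 1)
    rw [← pwLinear_partialTime (d := d) hd' hn.le, ← pwLinear_partialTime (d := d) hd' hn]
    exact ⟨hmono.monotoneOn (partialTime_nonneg hd' n) t.2 h1,
      hmono t.2 (partialTime_nonneg hd' (n + 1)) h2⟩

/-! ### Continuity of the alternating path in its holding times -/

theorem SkorokhodSpace.ofPath_val {g : ℝ≥0 → ℕ} (hg : IsCadlag g) :
    (SkorokhodSpace.ofPath g).1 = g := by
  simp [SkorokhodSpace.ofPath, hg]

theorem continuousOn_ofPath_altPath :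
    ContinuousOn (fun d => SkorokhodSpace.ofPath (altPath d)) {d | IsHoldingSeq d} := by
  intro d (hd : IsHoldingSeq d)
  refine tendsto_nhds.2 fun U hU hdU => ?_
  obtain ⟨T, δ, hδ, hsub⟩ := hU _ hdU
  -- The first `N` holding intervals cover `[0, T]` for `d`, hence also for every `d'` near it, so
  -- only finitely many coordinates matter.
  obtain ⟨N, hN⟩ := (hd.2.eventually_gt_atTop ((T : ℝ) + 1)).exists
  have hc1 : ∀ᶠ d' in 𝓝 d, ∑ k ∈ Finset.range N, |d k - d' k| < δ := by
    have : Continuous fun d' : ℕ → ℝ => ∑ k ∈ Finset.range N, |d k - d' k| := by fun_prop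
    refine (this.tendsto d).eventually_lt_const ?_
    simpa using hδ
  have hc2 : ∀ᶠ d' in 𝓝 d, (T : ℝ) < partialTime d' N := by
    have : Continuous fun d' : ℕ → ℝ => partialTime d' N := by unfold partialTime; fun_prop
    exact (this.tendsto d).eventually_const_lt (by linarith)
  filter_upwards [nhdsWithin_le_nhds hc1, nhdsWithin_le_nhds hc2, self_mem_nhdsWithin]
    with d' h1 h2 (hd' : IsHoldingSeq d')
  refine hsub ?_
  obtain ⟨lam, hlam, hlam'⟩ := exists_orderIso_partialTime hd.1 hd'.1 N
  refine ⟨lam, fun t ht => ⟨(hlam t).trans h1.le, ?_⟩⟩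
  rw [SkorokhodSpace.ofPath_val hd.isCadlag_altPath, SkorokhodSpace.ofPath_val hd'.isCadlag_altPath]
  obtain ⟨n, hn, hn'⟩ := hd'.exists_index t.2
  have hnN : n < N := (partialTime_strictMono hd'.1).lt_iff_lt.1
    (hn.trans_lt (lt_of_le_of_lt (by exact_mod_cast ht) h2))
  obtain ⟨h3, h4⟩ := hlam' n hnN t hn hn'
  rw [IsHoldingSeq.altPath_congr hd'.1 hd.1 hn hn' h3 h4, dist_self]
  exact hδ.le

theorem measurable_partialTime (n : ℕ) : Measurable fun d : ℕ → ℝ => partialTime d n := by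
  unfold partialTime
  fun_prop

theorem measurableSet_isHoldingSeq : MeasurableSet {d : ℕ → ℝ | IsHoldingSeq d} := by
  refine MeasurableSet.inter ?_ ?_
  · have : {d : ℕ → ℝ | ∀ n, 0 < d n} = ⋂ n, {d | 0 < d n} := by ext; simp
    change MeasurableSet {d : ℕ → ℝ | ∀ n, 0 < d n}
    rw [this]
    exact MeasurableSet.iInter fun n => measurableSet_lt measurable_const (measurable_pi_apply n)
  · exact measurableSet_tendsto _ fun n => measurable_partialTime n

/-! ### The switching path -/

theorem switchTime_le_succ (X : ℝ≥0 → ℝ) (y : ℝ) (n : ℕ) :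
    switchTime X y n ≤ switchTime X y (n + 1) := by
  rw [switchTime]
  exact le_sInf fun r ⟨t, hr, ht, _⟩ => hr ▸ ht

theorem switchTime_mono (X : ℝ≥0 → ℝ) (y : ℝ) : Monotone (switchTime X y) :=
  monotone_nat_of_le_succ (switchTime_le_succ X y)

-- The switching times increase, so the intervals in the sum are disjoint and at most one term is
-- nonzero.
open Classical in
theorem switchPath_eq_ite (X : ℝ≥0 → ℝ) (y : ℝ) (t : ℝ≥0) :
    switchPath X y t =
      if ∃ k, switchTime X y (2 * k + 1) ≤ t ∧ (t : ℝ≥0∞) < switchTime X y (2 * k + 2)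
      then 1 else 0 := by
  unfold switchPath
  split_ifs with h
  · obtain ⟨k, hk, hk'⟩ := h
    rw [tsum_eq_single k, Set.indicator_of_mem (show (t : ℝ≥0∞) ∈ Set.Ico _ _ from ⟨hk, hk'⟩)]
    intro j hj
    refine Set.indicator_of_notMem ?_ _
    rintro ⟨h1, h2⟩
    rcases lt_or_gt_of_ne hj with hlt | hlt
    · exact absurd (h2.trans_le ((switchTime_mono X y (by omega)).trans hk)) (lt_irrefl _)
    · exact absurd (hk'.trans_le ((switchTime_mono X y (by omega)).trans h1)) (lt_irrefl _)
  · push Not at h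
    have : ∀ k, Set.indicator (Set.Ico (switchTime X y (2 * k + 1)) (switchTime X y (2 * k + 2)))
        (fun _ => (1 : ℕ)) (t : ℝ≥0∞) = 0 := fun k => by
      refine Set.indicator_of_notMem ?_ _
      rintro ⟨h1, h2⟩
      exact absurd h2 (not_lt.2 (h k h1))
    simp [this]

theorem switchPath_eq_zero_or_one (X : ℝ≥0 → ℝ) (y : ℝ) (t : ℝ≥0) :
    switchPath X y t = 0 ∨ switchPath X y t = 1 := by
  classical
  rw [switchPath_eq_ite]
  split_ifs <;> simp

theorem switchPath_eq_altPath {X : ℝ≥0 → ℝ} {y : ℝ} {d : ℕ → ℝ}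
    (h : ∀ n, switchTime X y n = ENNReal.ofReal (partialTime d n)) :
    switchPath X y = altPath d := by
  classical
  ext t
  rw [switchPath_eq_ite, altPath]
  simp only [h]
  refine if_congr (exists_congr fun k => ?_) rfl rfl
  rw [← ENNReal.ofReal_coe_nnreal, ENNReal.ofReal_le_ofReal_iff (NNReal.coe_nonneg t),
    ENNReal.ofReal_lt_ofReal_iff_of_nonneg (NNReal.coe_nonneg t)]

theorem switchPath_eq_zero_of_le {X : ℝ≥0 → ℝ} {y : ℝ} (h : ∀ t, X t ≤ y) :
    switchPath X y = fun _ => 0 := by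
  classical
  have h1 : switchTime X y 1 = ⊤ := by
    rw [switchTime, sInf_eq_top]
    rintro r ⟨t, _, _, ht⟩
    rw [if_pos (by simp)] at ht
    exact absurd (h t) (not_le.2 ht)
  ext t
  rw [switchPath_eq_ite, if_neg]
  rintro ⟨k, hk, -⟩
  have := (switchTime_mono X y (show 1 ≤ 2 * k + 1 by omega)).trans hk
  rw [h1] at this
  exact absurd this (by simp)

/-- Every switching time is `0` here, as an infimum that need not be attained at the odd indices;
all the intervals of the sum are then empty. -/
theorem switchPath_eq_zero_of_frequently {X : ℝ≥0 → ℝ} {y : ℝ} (h0 : X 0 = 0)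
    (h : ∀ δ : ℝ≥0, 0 < δ → ∃ t < δ, y < X t) : switchPath X y = fun _ => 0 := by
  classical
  have h1 : ∀ n, switchTime X y n = 0 := by
    intro n
    induction n with
    | zero => rfl
    | succ n ih =>
      rw [switchTime, ih]
      rcases Nat.even_or_odd n with he | ho
      · simp only [he, if_true]
        refine nonpos_iff_eq_zero.1 (ENNReal.le_of_forall_pos_le_add fun δ hδ _ => ?_)
        obtain ⟨t, ht, hy⟩ := h δ hδ
        rw [zero_add]
        exact sInf_le_of_le ⟨t, rfl, zero_le, hy⟩ (by exact_mod_cast ht.le)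
      · simp only [Nat.not_even_iff_odd.2 ho, if_false]
        exact nonpos_iff_eq_zero.1 (sInf_le ⟨0, by simp, by simp, h0⟩)
  ext t
  rw [switchPath_eq_ite, if_neg]
  rintro ⟨k, -, hk⟩
  rw [h1] at hk
  exact absurd hk (by simp)

/-! ### The resetting path in terms of its gaps -/

theorem lastReset_eq {s : ℕ → ℝ} (hs : ∀ n, 0 < s n) {n : ℕ} {t : ℝ} (h : partialTime s n ≤ t)
    (h' : t < partialTime s (n + 1)) : lastReset s t = partialTime s n := by
  refine IsGreatest.csSup_eq ⟨⟨⟨n, rfl⟩, h⟩, ?_⟩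
  rintro r ⟨⟨m, rfl⟩, hm⟩
  have := (partialTime_strictMono hs).lt_iff_lt.1 (hm.trans_lt h')
  exact (partialTime_strictMono hs).monotone (by omega)

theorem resettingPath_eq (x : ℝ → ℝ) {s : ℕ → ℝ} (hs : ∀ n, 0 < s n) {n : ℕ} {t : ℝ≥0}
    (h : partialTime s n ≤ t) (h' : (t : ℝ) < partialTime s (n + 1)) :
    resettingPath x s t = x (t - partialTime s n) := by
  rw [resettingPath, lastReset_eq hs h h']

theorem lastReset_le {s : ℕ → ℝ} {t : ℝ} (ht : 0 ≤ t) : lastReset s t ≤ t :=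
  csSup_le ⟨0, ⟨0, partialTime_zero s⟩, ht⟩ fun _ hr => hr.2

theorem isHoldingSeq_of_frequently {s : ℕ → ℝ} {δ : ℝ} (hs : ∀ n, 0 < s n) (hδ : 0 < δ)
    (h : ∃ᶠ n in atTop, δ ≤ s n) : IsHoldingSeq s := by
  refine ⟨hs, ?_⟩
  have hmono := (partialTime_strictMono hs).monotone
  have key : ∀ K : ℕ, ∃ n, K * δ ≤ partialTime s n := by
    intro K
    induction K with
    | zero => exact ⟨0, by simp [partialTime_zero]⟩
    | succ K ih =>
      obtain ⟨n, hn⟩ := ih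
      obtain ⟨m, hm, hm'⟩ := frequently_atTop.1 h n
      refine ⟨m + 1, ?_⟩
      rw [partialTime_succ]
      push_cast
      linarith [hmono hm]
  refine tendsto_atTop_atTop_of_monotone hmono fun b => ?_
  obtain ⟨K, hK⟩ := exists_nat_gt (b / δ)
  obtain ⟨n, hn⟩ := key K
  exact ⟨n, ((div_lt_iff₀ hδ).1 hK).le.trans hn⟩

/-! ### Sojourns below and above a threshold age -/

/-- The first index at which a sequence exceeds the threshold `a`. -/
noncomputable def firstExceed (a : ℝ) (s : ℕ → ℝ) : ℕ := sInf {n | a < s n}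

/-- The sequence after the first term that exceeds `a`. -/
noncomputable def renew (a : ℝ) (s : ℕ → ℝ) : ℕ → ℝ := fun j => s (firstExceed a s + 1 + j)

/-- When a clock is reset at the end of successive gaps `s 0, s 1, …`, the durations of the
successive periods during which its value is, in turn, below and above the level `a`. -/
noncomputable def sojourn (a : ℝ) : ℕ → (ℕ → ℝ) → ℝ
  | 0, s => partialTime s (firstExceed a s) + a
  | 1, s => s (firstExceed a s) - a
  | n + 2, s => sojourn a n (renew a s)

theorem firstExceed_spec {a : ℝ} {s : ℕ → ℝ} (h : ∃ n, a < s n) : a < s (firstExceed a s) :=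
  Nat.sInf_mem (s := {n | a < s n}) h

theorem firstExceed_le {a : ℝ} {s : ℕ → ℝ} {n : ℕ} (h : a < s n) : firstExceed a s ≤ n :=
  Nat.sInf_le (s := {n | a < s n}) h

theorem firstExceed_eq {a : ℝ} {s : ℕ → ℝ} {n : ℕ} (h : a < s n) (h' : ∀ m < n, s m ≤ a) :
    firstExceed a s = n := by
  refine le_antisymm (firstExceed_le h) (not_lt.1 fun hlt => ?_)
  exact absurd (firstExceed_spec ⟨n, h⟩) (not_lt.2 (h' _ hlt))

theorem measurable_firstExceed (a : ℝ) : Measurable (firstExceed a) := by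
  refine measurable_to_countable' fun n => ?_
  have hm : ∀ k, MeasurableSet {s : ℕ → ℝ | a < s k} := fun k =>
    measurableSet_lt measurable_const (measurable_pi_apply k)
  have hA : MeasurableSet ({s : ℕ → ℝ | a < s n} ∩ ⋂ m ∈ Set.Iio n, {s : ℕ → ℝ | a < s m}ᶜ) :=
    (hm n).inter (MeasurableSet.biInter (Set.to_countable _) fun m _ => (hm m).compl)
  have hB : MeasurableSet (⋂ m, {s : ℕ → ℝ | a < s m}ᶜ) := MeasurableSet.iInter fun m => (hm m).compl
  -- Since `sInf ∅ = 0`, the fibre over `0` also contains the sequences that never exceed `a`.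
  have hset : firstExceed a ⁻¹' {n} =
      ({s : ℕ → ℝ | a < s n} ∩ ⋂ m ∈ Set.Iio n, {s : ℕ → ℝ | a < s m}ᶜ) ∪
        {s | s ∈ ⋂ m, {s : ℕ → ℝ | a < s m}ᶜ ∧ n = 0} := by
    ext s
    simp only [Set.mem_preimage, Set.mem_singleton_iff, Set.mem_union, Set.mem_inter_iff,
      Set.mem_iInter, Set.mem_compl_iff, Set.mem_Iio]
    by_cases h : ∃ k, a < s k
    · constructor
      · rintro rfl
        exact Or.inl ⟨firstExceed_spec h, fun m hm hlt => absurd (firstExceed_le hlt) (not_le.2 hm)⟩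
      · rintro (⟨h1, h2⟩ | ⟨h1, -⟩)
        · exact firstExceed_eq h1 fun m hm => not_lt.1 (h2 m hm)
        · obtain ⟨k, hk⟩ := h
          exact absurd hk (h1 k)
    · push Not at h
      have h0 : firstExceed a s = 0 := by
        have : {n | a < s n} = ∅ := Set.eq_empty_of_forall_notMem fun n hn => absurd hn (not_lt.2 (h n))
        rw [firstExceed, this, Nat.sInf_empty]
      rw [h0]
      constructor
      · rintro rfl
        exact Or.inr ⟨fun m => not_lt.2 (h m), rfl⟩
      · rintro (⟨h1, -⟩ | ⟨-, h1⟩)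
        · exact absurd h1 (not_lt.2 (h n))
        · exact h1.symm
  rw [hset]
  refine hA.union ?_
  by_cases hn : n = 0
  · simp only [hn, and_true]
    exact hB
  · simp [hn]

theorem measurable_eval_nat {α : Type*} [MeasurableSpace α] {N : α → ℕ} {g : α → ℕ → ℝ}
    (hN : Measurable N) (hg : ∀ n, Measurable fun x => g x n) : Measurable fun x => g x (N x) := by
  have : Measurable fun p : α × ℕ => g p.1 p.2 := measurable_from_prod_countable_left hg
  exact this.comp (measurable_id.prodMk hN)

theorem measurable_renew (a : ℝ) : Measurable (renew a) :=
  measurable_pi_lambda _ fun j => measurable_eval_nat (g := fun s i => s (i + 1 + j))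
    (measurable_firstExceed a) fun _ => measurable_pi_apply _

theorem measurable_sojourn (a : ℝ) : ∀ n, Measurable (sojourn a n)
  | 0 => by
    have : sojourn a 0 = fun s => partialTime s (firstExceed a s) + a := by ext s; simp [sojourn]
    rw [this]
    exact (measurable_eval_nat (measurable_firstExceed a) measurable_partialTime).add_const a
  | 1 => by
    have : sojourn a 1 = fun s => s (firstExceed a s) - a := by ext s; simp [sojourn]
    rw [this]
    exact (measurable_eval_nat (measurable_firstExceed a) measurable_pi_apply).sub_const a
  | n + 2 => by
    have : sojourn a (n + 2) = fun s => sojourn a n (renew a s) := by ext s; simp [sojourn]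
    rw [this]
    exact (measurable_sojourn a n).comp (measurable_renew a)

theorem sojourn_add_two (a : ℝ) (n : ℕ) (s : ℕ → ℝ) :
    sojourn a (n + 2) s = sojourn a n (renew a s) := by rw [sojourn]

theorem frequently_shift {p : ℕ → Prop} (h : ∃ᶠ n in atTop, p n) (m : ℕ) :
    ∃ᶠ n in atTop, p (m + n) := by
  rw [frequently_atTop] at h ⊢
  intro k
  obtain ⟨n, hn, hp⟩ := h (m + k)
  exact ⟨n - m, by omega, by rwa [Nat.add_sub_cancel' (by omega)]⟩

theorem sojourn_pos {a : ℝ} (ha : 0 < a) : ∀ (n : ℕ) {s : ℕ → ℝ}, (∀ n, 0 < s n) →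
    (∃ᶠ n in atTop, a < s n) → 0 < sojourn a n s
  | 0, s, hs, _ => by
    rw [sojourn]
    exact add_pos_of_nonneg_of_pos (partialTime_nonneg hs _) ha
  | 1, s, _, h => by
    rw [sojourn]
    exact sub_pos.2 (firstExceed_spec h.exists)
  | n + 2, s, hs, h => by
    rw [sojourn_add_two]
    exact sojourn_pos ha n (fun j => hs _) (frequently_shift h _)

theorem le_sojourn_even {a : ℝ} : ∀ (k : ℕ) {s : ℕ → ℝ}, (∀ n, 0 < s n) → a ≤ sojourn a (2 * k) s
  | 0, s, hs => by
    rw [mul_zero, sojourn]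
    exact le_add_of_nonneg_left (partialTime_nonneg hs _)
  | k + 1, s, hs => by
    rw [Nat.mul_succ, sojourn_add_two]
    exact le_sojourn_even k fun j => hs _

/-- Each sojourn below the level lasts at least `a`, which makes the sum diverge. -/
theorem isHoldingSeq_sojourn {a : ℝ} (ha : 0 < a) {s : ℕ → ℝ} (hs : ∀ n, 0 < s n)
    (h : ∃ᶠ n in atTop, a < s n) : IsHoldingSeq fun n => sojourn a n s := by
  refine isHoldingSeq_of_frequently (fun n => sojourn_pos ha n hs h) ha ?_
  exact frequently_atTop.2 fun k => ⟨2 * k, by omega, le_sojourn_even k hs⟩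

/-- Only approximation from above is asked for, because the infimum is not attained at an
upcrossing: at age exactly `a` the path equals the level without exceeding it. -/
theorem sInf_image_coe_eq {Q : ℝ≥0 → Prop} {c v : ℝ}
    (hlow : ∀ t : ℝ≥0, c ≤ t → Q t → v ≤ t)
    (hup : ∀ δ : ℝ, 0 < δ → ∃ t : ℝ≥0, c ≤ t ∧ Q t ∧ (t : ℝ) ≤ v + δ) :
    sInf {r : ℝ≥0∞ | ∃ t : ℝ≥0, r = t ∧ ENNReal.ofReal c ≤ t ∧ Q t} = ENNReal.ofReal v := by
  have hconv : ∀ t : ℝ≥0, ENNReal.ofReal c ≤ t ↔ c ≤ t := fun t => by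
    rw [← ENNReal.ofReal_coe_nnreal, ENNReal.ofReal_le_ofReal_iff (NNReal.coe_nonneg t)]
  apply le_antisymm
  · refine ENNReal.le_of_forall_pos_le_add fun δ hδ _ => ?_
    obtain ⟨t, h1, h2, h3⟩ := hup δ hδ
    refine sInf_le_of_le ⟨t, rfl, (hconv t).2 h1, h2⟩ ?_
    rw [← ENNReal.ofReal_coe_nnreal (p := t), ← ENNReal.ofReal_coe_nnreal (p := δ)]
    exact (ENNReal.ofReal_le_ofReal h3).trans ENNReal.ofReal_add_le
  · refine le_sInf ?_
    rintro r ⟨t, rfl, h1, h2⟩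
    rw [← ENNReal.ofReal_coe_nnreal]
    exact ENNReal.ofReal_le_ofReal (hlow t ((hconv t).1 h1) h2)

/-! ### Switching times as partial sums of sojourns -/

section Switch

variable {x : ℝ → ℝ} {y a : ℝ} {s : ℕ → ℝ}

/-- Starting from a reset, the age first exceeds `a` during the first gap longer than `a`, and it
reaches `a` at delay `a` after the start of that gap. -/
theorem switchTime_up (ha : 0 < a) (hxy : ∀ t, 0 ≤ t → (y < x t ↔ a < t)) (hs : ∀ n, 0 < s n)
    (h : ∃ᶠ n in atTop, a < s n) (k m : ℕ)
    (hk : switchTime (resettingPath x s) y (2 * k) = ENNReal.ofReal (partialTime s m)) :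
    switchTime (resettingPath x s) y (2 * k + 1) = ENNReal.ofReal
      (partialTime s (m + firstExceed a (fun j => s (m + j))) + a) := by
  have hspec := firstExceed_spec (frequently_shift h m).exists
  have hS := isHoldingSeq_of_frequently hs ha (h.mono fun n hn => hn.le)
  have hmono := (partialTime_strictMono hs)
  rw [switchTime, hk]
  simp only [show Even (2 * k) by simp, if_true]
  set N := firstExceed a fun j => s (m + j) with hN
  refine sInf_image_coe_eq (fun t ht hy => ?_) fun δ hδ => ?_
  · obtain ⟨n, hn, hn'⟩ := hS.exists_index (NNReal.coe_nonneg t)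
    rw [resettingPath_eq x hs hn hn', hxy _ (sub_nonneg.2 hn)] at hy
    have hmn := hmono.lt_iff_lt.1 (ht.trans_lt hn')
    have h1 : a < s (m + (n - m)) := by
      rw [Nat.add_sub_cancel' (by omega)]
      rw [partialTime_succ] at hn'
      linarith
    have h2 : N ≤ n - m := firstExceed_le (s := fun j => s (m + j)) h1
    have := hmono.monotone (show m + N ≤ n by omega)
    linarith
  -- Half of the excess of the gap over `a` keeps the witness before the next reset.
  · set δ' := min δ ((s (m + N) - a) / 2) with hδ'
    have h0 : 0 < δ' := lt_min hδ (by linarith)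
    have h1 : δ' ≤ (s (m + N) - a) / 2 := min_le_right _ _
    have hpos : 0 ≤ partialTime s (m + N) + a + δ' := by
      linarith [partialTime_nonneg hs (m + N)]
    have hle := hmono.monotone (Nat.le_add_right m N)
    obtain ⟨t, ht⟩ : ∃ t : ℝ≥0, (t : ℝ) = partialTime s (m + N) + a + δ' := ⟨⟨_, hpos⟩, rfl⟩
    refine ⟨t, by linarith, ?_, by linarith [min_le_left δ ((s (m + N) - a) / 2)]⟩
    rw [resettingPath_eq x hs (n := m + N), hxy]
    · linarith
    · linarith
    · linarith
    · rw [partialTime_succ]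
      linarith

/-- The flow vanishes only at time `0`, so the zeros of the resetting path are exactly the reset
times. -/
theorem switchTime_down (ha : 0 < a) (hx0 : ∀ t, 0 ≤ t → (x t = 0 ↔ t = 0)) (hs : ∀ n, 0 < s n)
    (h : ∃ᶠ n in atTop, a < s n) (k m : ℕ) (hm : a < s m)
    (hk : switchTime (resettingPath x s) y (2 * k + 1) = ENNReal.ofReal (partialTime s m + a)) :
    switchTime (resettingPath x s) y (2 * k + 2) = ENNReal.ofReal (partialTime s (m + 1)) := by
  have hS := isHoldingSeq_of_frequently hs ha (h.mono fun n hn => hn.le)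
  have hmono := (partialTime_strictMono hs)
  rw [switchTime, hk]
  simp only [show ¬ Even (2 * k + 1) by simp, if_false]
  have hmn := partialTime_nonneg hs m
  refine sInf_image_coe_eq (fun t ht hy => ?_) fun δ hδ => ?_
  · obtain ⟨n, hn, hn'⟩ := hS.exists_index (NNReal.coe_nonneg t)
    rw [resettingPath_eq x hs hn hn', hx0 _ (sub_nonneg.2 hn), sub_eq_zero] at hy
    rw [hy] at ht ⊢
    have := hmono.lt_iff_lt.1 (show partialTime s m < partialTime s n by linarith)
    exact hmono.monotone this
  · obtain ⟨t, ht⟩ : ∃ t : ℝ≥0, (t : ℝ) = partialTime s (m + 1) :=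
      ⟨⟨_, partialTime_nonneg hs (m + 1)⟩, rfl⟩
    refine ⟨t, ?_, ?_, by linarith⟩
    · rw [ht, partialTime_succ]
      linarith
    · rw [resettingPath_eq x hs (n := m + 1) ht.ge (ht.trans_lt (hmono (Nat.lt_succ_self _))),
        hx0 _ (sub_nonneg.2 ht.ge), ht, sub_self]

/-- The renewal structure: `k` complete cycles end at some reset, and the later sojourns are those
of the shifted gaps. Within a cycle the `+ a` of the first sojourn cancels the `- a` of the second.
-/
theorem exists_partialTime_sojourn (a : ℝ) (s : ℕ → ℝ) (k : ℕ) : ∃ m,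
    (∀ n, sojourn a (2 * k + n) s = sojourn a n fun j => s (m + j)) ∧
      partialTime (fun n => sojourn a n s) (2 * k) = partialTime s m := by
  induction k with
  | zero => exact ⟨0, by simp, by simp [partialTime_zero]⟩
  | succ k ih =>
    obtain ⟨m, h1, h2⟩ := ih
    set N := firstExceed a (fun j => s (m + j)) with hN
    refine ⟨m + N + 1, fun n => ?_, ?_⟩
    · rw [show 2 * (k + 1) + n = 2 * k + (n + 2) by ring, h1, sojourn_add_two]
      congr 1
      ext j
      simp only [renew]
      congr 1
      omega
    · have e0 := h1 0
      have e1 := h1 1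
      simp only [sojourn, ← hN] at e0 e1
      rw [show 2 * (k + 1) = 2 * k + 1 + 1 by ring, partialTime_succ, partialTime_succ, h2,
        partialTime_succ, partialTime_add, e1]
      simp only [add_zero] at e0
      rw [e0]
      ring

theorem switchTime_resettingPath (ha : 0 < a) (hxy : ∀ t, 0 ≤ t → (y < x t ↔ a < t))
    (hx0 : ∀ t, 0 ≤ t → (x t = 0 ↔ t = 0)) (hs : ∀ n, 0 < s n) (h : ∃ᶠ n in atTop, a < s n)
    (n : ℕ) : switchTime (resettingPath x s) y n =
      ENNReal.ofReal (partialTime (fun i => sojourn a i s) n) := by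
  have hup : ∀ k, switchTime (resettingPath x s) y (2 * k) =
      ENNReal.ofReal (partialTime (fun i => sojourn a i s) (2 * k)) →
      switchTime (resettingPath x s) y (2 * k + 1) =
      ENNReal.ofReal (partialTime (fun i => sojourn a i s) (2 * k + 1)) := by
    intro k hk
    obtain ⟨m, h1, h2⟩ := exists_partialTime_sojourn a s k
    have e0 := h1 0
    simp only [sojourn, add_zero] at e0
    rw [h2] at hk
    rw [switchTime_up ha hxy hs h k m hk, partialTime_succ, e0, h2, partialTime_add]
    ring_nf
  have heven : ∀ k, switchTime (resettingPath x s) y (2 * k) =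
      ENNReal.ofReal (partialTime (fun i => sojourn a i s) (2 * k)) := by
    intro k
    induction k with
    | zero => simp [switchTime, partialTime_zero]
    | succ k ih =>
      have hk := hup k ih
      obtain ⟨m, h1, h2⟩ := exists_partialTime_sojourn a s k
      have e0 := h1 0
      have e1 := h1 1
      simp only [sojourn, add_zero] at e0 e1
      have e : partialTime (fun i => sojourn a i s) (2 * k + 1) =
          partialTime s (m + firstExceed a fun j => s (m + j)) + a := by
        rw [partialTime_succ, e0, h2, partialTime_add]
        ring
      rw [e] at hk
      have hspec := firstExceed_spec (frequently_shift h m).exists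
      rw [show 2 * (k + 1) = 2 * k + 1 + 1 by ring,
        switchTime_down ha hx0 hs h k _ hspec hk, partialTime_succ, partialTime_succ, e, e1]
      ring_nf
  obtain ⟨k, rfl | rfl⟩ := Nat.even_or_odd' n
  · exact heven k
  · exact hup k (heven k)

theorem switchPath_resettingPath (ha : 0 < a) (hxy : ∀ t, 0 ≤ t → (y < x t ↔ a < t))
    (hx0 : ∀ t, 0 ≤ t → (x t = 0 ↔ t = 0)) (hs : ∀ n, 0 < s n) (h : ∃ᶠ n in atTop, a < s n) :
    switchPath (resettingPath x s) y = altPath fun n => sojourn a n s :=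
  switchPath_eq_altPath
    (switchTime_resettingPath ha hxy hx0 hs h)

end Switch

/-! ### Weak convergence -/

/-- The continuous mapping theorem for a map that is continuous on a measurable set which carries
the limit law and, eventually, the laws of the sequence. -/
theorem TendstoInDistribution.continuousOn_comp {ι E F Ω' : Type*} {Ω : ι → Type*}
    [∀ i, MeasurableSpace (Ω i)] {P : (i : ι) → Measure (Ω i)} [∀ i, IsProbabilityMeasure (P i)]
    [MeasurableSpace Ω'] {P' : Measure Ω'} [IsProbabilityMeasure P']
    [TopologicalSpace E] [MeasurableSpace E] [OpensMeasurableSpace E] [HasOuterApproxClosed E]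
    [TopologicalSpace F] [MeasurableSpace F] [BorelSpace F]
    {l : Filter ι} [l.IsCountablyGenerated] {X : (i : ι) → Ω i → E} {Z : Ω' → E}
    {Y : (i : ι) → Ω i → F} {W : Ω' → F}
    {S : Set E} {Φ : E → F} (hΦ : ContinuousOn Φ S)
    (h : TendstoInDistribution X l Z P P')
    (hY : ∀ i, AEMeasurable (Y i) (P i)) (hW : AEMeasurable W P')
    (hXY : ∀ᶠ i in l, ∀ᵐ ω ∂(P i), X i ω ∈ S ∧ Y i ω = Φ (X i ω))
    (hZW : ∀ᵐ ω ∂P', Z ω ∈ S ∧ W ω = Φ (Z ω)) :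
    TendstoInDistribution Y l W P P' := by
  refine ⟨hY, hW, tendsto_of_forall_isOpen_le_liminf' fun U hU => ?_⟩
  obtain ⟨V, hV, hVU⟩ := continuousOn_iff'.1 hΦ U hU
  have key : ∀ e, e ∈ S → (Φ e ∈ U ↔ e ∈ V) := fun e he => by
    have := Set.ext_iff.1 hVU e
    simp only [Set.mem_inter_iff, Set.mem_preimage, he, and_true] at this
    exact this
  have hlim := ProbabilityMeasure.le_liminf_measure_open_of_tendsto h.tendsto hV
  simp only [ProbabilityMeasure.coe_mk] at hlim ⊢
  rw [Measure.map_apply_of_aemeasurable h.aemeasurable_limit hV.measurableSet] at hlim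
  rw [Measure.map_apply_of_aemeasurable hW hU.measurableSet]
  have e1 : P' (W ⁻¹' U) = P' (Z ⁻¹' V) := measure_congr <| by
    filter_upwards [hZW] with ω hω
    exact propext (by
      change W ω ∈ U ↔ Z ω ∈ V
      rw [hω.2, key _ hω.1])
  rw [e1]
  refine hlim.trans (liminf_le_liminf ?_)
  filter_upwards [hXY] with i hi
  rw [Measure.map_apply_of_aemeasurable (h.forall_aemeasurable i) hV.measurableSet,
    Measure.map_apply_of_aemeasurable (hY i) hU.measurableSet]
  refine (measure_congr ?_).le
  filter_upwards [hi] with ω hω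
  exact propext (by
    change X i ω ∈ V ↔ Y i ω ∈ U
    rw [hω.2, key _ hω.1])

/-- Open sets of `ℕ → ℝ` are increasing unions of open cylinders. -/
theorem exists_monotone_isOpen_cylinder {V : Set (ℕ → ℝ)} (hV : IsOpen V) :
    ∃ W : (k : ℕ) → Set (EuclideanSpace ℝ (Fin (2 * k))), (∀ k, IsOpen (W k)) ∧
      Monotone (fun k => (fun d : ℕ → ℝ => WithLp.toLp 2 fun i : Fin (2 * k) => d i) ⁻¹' W k) ∧
      V = ⋃ k, (fun d : ℕ → ℝ => WithLp.toLp 2 fun i : Fin (2 * k) => d i) ⁻¹' W k := by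
  let π : (k : ℕ) → (ℕ → ℝ) → EuclideanSpace ℝ (Fin (2 * k)) :=
    fun k d => WithLp.toLp 2 fun i : Fin (2 * k) => d i
  let ext : (k : ℕ) → EuclideanSpace ℝ (Fin (2 * k)) → (ℕ → ℝ) := fun k w n =>
    if hn : n < 2 * k then w ⟨n, hn⟩ else 0
  have hπ : ∀ k, Continuous (π k) := fun k => by fun_prop
  have hπext : ∀ k w, π k (ext k w) = w := fun k w => by
    ext i
    simp [π, ext]
  -- `C k` is the largest open set whose cylinder lies in `V`. This choice makes the cylinders
  -- increase with `k`; a basic neighbourhood of a point of `V` involves finitely many coordinates,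
  -- so they exhaust `V`.
  let C : (k : ℕ) → Set (EuclideanSpace ℝ (Fin (2 * k))) := fun k =>
    {w | ∃ U : Set (EuclideanSpace ℝ (Fin (2 * k))), IsOpen U ∧ w ∈ U ∧ π k ⁻¹' U ⊆ V}
  have hC : ∀ k d, π k d ∈ C k ↔ ∃ U, IsOpen U ∧ π k d ∈ U ∧ π k ⁻¹' U ⊆ V := fun k d => Iff.rfl
  refine ⟨C, fun k => ?_, ?_, ?_⟩
  · rw [isOpen_iff_forall_mem_open]
    rintro w ⟨U, hU, hwU, hUV⟩
    exact ⟨U, fun w' hw' => ⟨U, hU, hw', hUV⟩, hU, hwU⟩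
  · intro k m hkm d hd
    obtain ⟨U, hU, hwU, hUV⟩ := (hC k d).1 hd
    let ρ : EuclideanSpace ℝ (Fin (2 * m)) → EuclideanSpace ℝ (Fin (2 * k)) := fun w =>
      WithLp.toLp 2 fun i : Fin (2 * k) => w ⟨i, by omega⟩
    have hρ : Continuous ρ := by fun_prop
    exact (hC m d).2 ⟨ρ ⁻¹' U, hU.preimage hρ, hwU, fun d' hd' => hUV hd'⟩
  · ext d
    simp only [Set.mem_iUnion, Set.mem_preimage]
    constructor
    · intro hd
      obtain ⟨I, u, hu, hsub⟩ := isOpen_pi_iff.1 hV d hd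
      obtain ⟨k, hk⟩ : ∃ k, ∀ i ∈ I, i < 2 * k := by
        refine ⟨I.sup id + 1, fun i hi => ?_⟩
        have := Finset.le_sup (f := id) hi
        simp only [id] at this
        omega
      refine ⟨k, (hC k d).2 ⟨{w | ∀ i : Fin (2 * k), (i : ℕ) ∈ I → w i ∈ u i}, ?_, ?_, ?_⟩⟩
      · have : {w : EuclideanSpace ℝ (Fin (2 * k)) | ∀ i : Fin (2 * k), (i : ℕ) ∈ I → w i ∈ u i}
            = ⋂ i : Fin (2 * k), ⋂ _ : (i : ℕ) ∈ I, (fun w => w i) ⁻¹' u i := by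
          ext w; simp
        rw [this]
        refine isOpen_iInter_of_finite fun i => isOpen_iInter_of_finite fun hi => ?_
        exact (hu i hi).1.preimage (by fun_prop)
      · exact fun i hi => (hu i hi).2
      · exact fun d' hd' => hsub fun i hi => hd' ⟨i, hk i hi⟩ hi
    · rintro ⟨k, hk⟩
      obtain ⟨U, -, hwU, hUV⟩ := (hC k d).1 hk
      exact hUV hwU

/-- Convergence in law of random sequences, from the convergence of the characteristic functions of
their initial segments. -/
theorem tendstoInDistribution_of_tendsto_charFun {ι Ω' : Type*} {Ω : ι → Type*}
    [∀ i, MeasurableSpace (Ω i)] {P : (i : ι) → Measure (Ω i)} [∀ i, IsProbabilityMeasure (P i)]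
    [MeasurableSpace Ω'] {P' : Measure Ω'} [IsProbabilityMeasure P']
    {l : Filter ι} [l.IsCountablyGenerated] {X : (i : ι) → Ω i → ℕ → ℝ} {Z : Ω' → ℕ → ℝ}
    (hX : ∀ i, Measurable (X i)) (hZ : Measurable Z)
    (h : ∀ (k : ℕ) (t : EuclideanSpace ℝ (Fin (2 * k))), Tendsto (fun i =>
      charFun ((P i).map fun ω => WithLp.toLp 2 fun j : Fin (2 * k) => X i ω j) t) l
      (𝓝 (charFun (P'.map fun ω => WithLp.toLp 2 fun j : Fin (2 * k) => Z ω j) t))) :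
    TendstoInDistribution X l Z P P' := by
  refine ⟨fun i => (hX i).aemeasurable, hZ.aemeasurable,
    tendsto_of_forall_isOpen_le_liminf' fun V hV => ?_⟩
  obtain ⟨W, hW, hmono, rfl⟩ := exists_monotone_isOpen_cylinder hV
  simp only [ProbabilityMeasure.coe_mk]
  -- The measure of an increasing union is a supremum, so the portmanteau lower bound only has to be
  -- checked on each cylinder.
  rw [hmono.measure_iUnion]
  refine iSup_le fun k => ?_
  have hmX : ∀ i, Measurable fun ω => WithLp.toLp 2 fun j : Fin (2 * k) => X i ω j := fun i => by
    have := hX i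
    fun_prop
  have hmZ : Measurable fun ω => WithLp.toLp 2 fun j : Fin (2 * k) => Z ω j := by fun_prop
  have hpm : Measurable fun d : ℕ → ℝ => WithLp.toLp 2 fun j : Fin (2 * k) => d j := by fun_prop
  have hlim : Tendsto (β := ProbabilityMeasure (EuclideanSpace ℝ (Fin (2 * k))))
      (fun i => ⟨_, Measure.isProbabilityMeasure_map (hmX i).aemeasurable⟩) l
      (𝓝 ⟨_, Measure.isProbabilityMeasure_map hmZ.aemeasurable⟩) :=
    -- The filter is countably generated, so Lévy's continuity theorem may be applied along
    -- sequences.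
    tendsto_of_seq_tendsto fun u hu =>
      ProbabilityMeasure.tendsto_of_tendsto_charFun fun t => (h k t).comp hu
  have hle := ProbabilityMeasure.le_liminf_measure_open_of_tendsto hlim (hW k)
  simp only [ProbabilityMeasure.coe_mk] at hle
  rw [Measure.map_apply hmZ (hW k).measurableSet] at hle
  rw [Measure.map_apply hZ (hpm (hW k).measurableSet)]
  refine hle.trans (liminf_le_liminf (Eventually.of_forall fun i => ?_))
  rw [Measure.map_apply (hmX i) (hW k).measurableSet]
  refine le_trans ?_ (measure_mono (Set.subset_iUnion _ k))
  rw [Measure.map_apply (hX i) (hpm (hW k).measurableSet)]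
  exact le_rfl

/-- The map is continuous on the measurable set of holding sequences, which carries the law;
redefining it as a constant elsewhere makes it Borel. -/
theorem aemeasurable_ofPath_altPath {Ω : Type*} [MeasurableSpace Ω] {P : Measure Ω}
    {D : Ω → ℕ → ℝ} (hD : Measurable D) (h : ∀ᵐ ω ∂P, IsHoldingSeq (D ω)) :
    AEMeasurable (fun ω => SkorokhodSpace.ofPath (altPath (D ω))) P := by
  classical
  have hc := continuousOn_iff_continuous_domRestrict.1 continuousOn_ofPath_altPath
  have hm : Measurable ({d | IsHoldingSeq d}.piecewise
      (fun d => SkorokhodSpace.ofPath (altPath d)) fun _ => SkorokhodSpace.ofPath fun _ => 0) := by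
    refine measurable_of_restrict_of_restrict_compl measurableSet_isHoldingSeq ?_ ?_
    · rw [Set.domRestrict_piecewise]
      exact hc.measurable
    · rw [Set.domRestrict_piecewise_compl]
      exact measurable_const
  refine ⟨_, hm.comp hD, ?_⟩
  filter_upwards [h] with ω hω
  exact (Set.piecewise_eq_of_mem {d | IsHoldingSeq d}
    (fun d => SkorokhodSpace.ofPath (altPath d)) (fun _ => SkorokhodSpace.ofPath fun _ => 0) hω).symm

/-! ### Independent gaps -/

/-- In a sequence of independent random variables which all exceed `a` with probability at least
`p > 0`, infinitely many do so. -/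
theorem ae_frequently_lt {Ω : Type*} [MeasurableSpace Ω] {P : Measure Ω} [IsProbabilityMeasure P]
    {σ : ℕ → Ω → ℝ} (hm : ∀ n, Measurable (σ n)) (hind : iIndepFun σ P) {a : ℝ} {p : ℝ≥0∞}
    (hp : p ≠ 0) (h : ∀ n, p ≤ P {ω | a < σ n ω}) : ∀ᵐ ω ∂P, ∃ᶠ n in atTop, a < σ n ω := by
  have hms : ∀ n, MeasurableSet {ω | a < σ n ω} := fun n => measurableSet_lt measurable_const (hm n)
  have hi : iIndepSet (fun n => {ω | a < σ n ω}) P := by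
    rw [iIndepSet_iff_meas_biInter hms]
    intro I
    exact hind.measure_inter_preimage_eq_mul I (sets := fun _ => Set.Ioi a)
      fun _ _ => measurableSet_Ioi
  have hsum : ∑' n, P {ω | a < σ n ω} = ∞ := by
    refine top_le_iff.1 ?_
    rw [← ENNReal.tsum_const_eq_top_of_ne_zero (α := ℕ) hp]
    exact ENNReal.tsum_le_tsum h
  have := measure_limsup_eq_one hms hi hsum
  have hl : MeasurableSet (limsup (fun n => {ω | a < σ n ω}) atTop) :=
    MeasurableSet.measurableSet_limsup hms
  filter_upwards [(prob_compl_eq_zero_iff hl).2 this |> compl_mem_ae_iff.2] with ω hω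
  rw [compl_compl] at hω
  exact mem_limsup_iff_frequently_mem.1 hω

/-! ### One-step analysis of the sojourns -/

/-- The sequence `u, s 0, s 1, …`. -/
def seqCons (u : ℝ) (s : ℕ → ℝ) : ℕ → ℝ
  | 0 => u
  | n + 1 => s n

theorem measurable_seqCons : Measurable fun p : ℝ × (ℕ → ℝ) => seqCons p.1 p.2 := by
  refine measurable_pi_lambda _ fun n => ?_
  cases n with
  | zero => exact measurable_fst
  | succ n => exact (measurable_pi_apply n).comp measurable_snd

/-- Prepending an independent term leaves the law of an i.i.d. sequence unchanged. This is what
allows conditioning on the first gap. -/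
theorem map_seqCons_prod_infinitePi (ν : Measure ℝ) [IsProbabilityMeasure ν] :
    (ν.prod (Measure.infinitePi fun _ : ℕ => ν)).map (fun p => seqCons p.1 p.2) =
      Measure.infinitePi fun _ : ℕ => ν := by
  classical
  refine Measure.eq_infinitePi _ fun I t ht => ?_
  obtain ⟨n, hn⟩ : ∃ n, ∀ i ∈ I, i < n + 1 :=
    ⟨I.sup id, fun i hi => Nat.lt_succ_of_le (Finset.le_sup (f := id) hi)⟩
  -- Padding with `Set.univ` turns the index set into an initial segment, from which coordinate `0`
  -- splits off.
  let t' : ℕ → Set ℝ := fun i => if i ∈ I then t i else Set.univ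
  have ht' : ∀ i, MeasurableSet (t' i) := fun i => by
    by_cases h : i ∈ I
    · simpa [t', h] using ht i
    · simp [t', h]
  have hpi : Set.pi (I : Set ℕ) t = Set.pi (Finset.range (n + 1) : Set ℕ) t' := by
    ext d
    constructor
    · intro hd i _
      by_cases h : i ∈ I
      · simpa [t', h] using hd i h
      · simp [t', h]
    · intro hd i hi
      simpa [t', Finset.mem_coe.1 hi] using hd i (by simpa using hn i hi)
  have hprod : ∏ i ∈ I, ν (t i) = ∏ i ∈ Finset.range (n + 1), ν (t' i) := by
    rw [← Finset.prod_subset (fun i hi => Finset.mem_range.2 (hn i hi))]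
    · exact Finset.prod_congr rfl fun i hi => by simp [t', hi]
    · intro i _ hi
      simp [t', hi]
  have hpre : (fun p : ℝ × (ℕ → ℝ) => seqCons p.1 p.2) ⁻¹' Set.pi (Finset.range (n + 1) : Set ℕ) t'
      = t' 0 ×ˢ Set.pi (Finset.range n : Set ℕ) fun i => t' (i + 1) := by
    ext ⟨u, s⟩
    simp only [Set.mem_preimage, Set.mem_pi, Finset.coe_range, Set.mem_Iio, Set.mem_prod]
    constructor
    · exact fun h => ⟨h 0 (Nat.succ_pos n), fun i hi => h (i + 1) (Nat.succ_lt_succ hi)⟩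
    · rintro ⟨h0, h⟩ i hi
      cases i with
      | zero => exact h0
      | succ i => exact h i (Nat.lt_of_succ_lt_succ hi)
  rw [hpi, hprod, Measure.map_apply measurable_seqCons
    (MeasurableSet.pi (Set.to_countable _) fun i _ => ht' i), hpre, Measure.prod_prod,
    Measure.infinitePi_pi _ fun i _ => ht' _, Finset.prod_range_succ', mul_comm]

section OneStep

variable {a u : ℝ} {s : ℕ → ℝ}

theorem firstExceed_seqCons_of_lt (h : a < u) : firstExceed a (seqCons u s) = 0 :=
  firstExceed_eq h fun m hm => absurd hm (Nat.not_lt_zero m)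

theorem firstExceed_seqCons_of_le (h : u ≤ a) (hs : ∃ n, a < s n) :
    firstExceed a (seqCons u s) = firstExceed a s + 1 := by
  refine firstExceed_eq (n := firstExceed a s + 1) (firstExceed_spec hs) fun m hm => ?_
  cases m with
  | zero => exact h
  | succ m =>
    exact not_lt.1 fun hlt =>
      absurd (firstExceed_le (s := s) hlt) (not_le.2 (Nat.lt_of_succ_lt_succ hm))

theorem partialTime_seqCons (n : ℕ) :
    partialTime (seqCons u s) (n + 1) = u + partialTime s n := by
  simp only [partialTime, Finset.sum_range_succ', seqCons]
  ring

theorem renew_seqCons_of_lt (h : a < u) : renew a (seqCons u s) = s := by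
  ext j
  rw [renew, firstExceed_seqCons_of_lt h, show 0 + 1 + j = j + 1 by ring, seqCons]

theorem renew_seqCons_of_le (h : u ≤ a) (hs : ∃ n, a < s n) :
    renew a (seqCons u s) = renew a s := by
  ext j
  rw [renew, renew, firstExceed_seqCons_of_le h hs,
    show firstExceed a s + 1 + 1 + j = firstExceed a s + 1 + j + 1 by ring, seqCons]

/-- A long first gap contains the whole first cycle: the sojourn below is `a`, the one above is `u -
a`, and the remaining gaps start afresh. -/
theorem sum_sojourn_seqCons_of_lt (h : a < u) (k : ℕ) (ξ : ℕ → ℝ) :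
    ∑ j ∈ Finset.range (2 * (k + 1)), ξ j * sojourn a j (seqCons u s) =
      ξ 0 * a + ξ 1 * (u - a) + ∑ j ∈ Finset.range (2 * k), ξ (j + 2) * sojourn a j s := by
  rw [show 2 * (k + 1) = 2 * k + 1 + 1 by ring, Finset.sum_range_succ', Finset.sum_range_succ']
  simp only [sojourn_add_two, renew_seqCons_of_lt h]
  simp only [sojourn, firstExceed_seqCons_of_lt h, partialTime_zero, seqCons, zero_add]
  ring

/-- A short first gap only lengthens the first sojourn by `u`. -/
theorem sum_sojourn_seqCons_of_le (h : u ≤ a) (hs : ∃ n, a < s n) (k : ℕ) (ξ : ℕ → ℝ) :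
    ∑ j ∈ Finset.range (2 * (k + 1)), ξ j * sojourn a j (seqCons u s) =
      ξ 0 * u + ∑ j ∈ Finset.range (2 * (k + 1)), ξ j * sojourn a j s := by
  rw [show 2 * (k + 1) = 2 * k + 1 + 1 by ring]
  simp only [Finset.sum_range_succ', sojourn_add_two, renew_seqCons_of_le h hs]
  simp only [sojourn, firstExceed_seqCons_of_le h hs, partialTime_seqCons, seqCons, zero_add]
  ring

end OneStep

/-- The joint characteristic function of the first `2 * k` sojourns, for independent gaps of
law `ν`. -/
noncomputable def sojournChar (ν : Measure ℝ) [IsProbabilityMeasure ν] (a : ℝ) (k : ℕ)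
    (ξ : ℕ → ℝ) : ℂ :=
  ∫ s, Complex.exp (((∑ j ∈ Finset.range (2 * k), ξ j * sojourn a j s : ℝ) : ℂ) * Complex.I)
    ∂Measure.infinitePi fun _ : ℕ => ν

theorem integrable_exp_ofReal_mul_I {α : Type*} [MeasurableSpace α] {μ : Measure α}
    [IsFiniteMeasure μ] {g : α → ℝ} (hg : Measurable g) :
    Integrable (fun x => Complex.exp ((g x : ℂ) * Complex.I)) μ := by
  refine Integrable.of_bound (C := 1) (by fun_prop) (Eventually.of_forall fun x => ?_)
  rw [Complex.norm_exp_ofReal_mul_I]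

theorem ae_infinitePi_exists_lt {ν : Measure ℝ} [IsProbabilityMeasure ν] {a : ℝ}
    (hp : ν (Set.Ioi a) ≠ 0) :
    ∀ᵐ s ∂(Measure.infinitePi fun _ : ℕ => ν), ∃ n, a < s n := by
  have hind : iIndepFun (fun n (s : ℕ → ℝ) => s n) (Measure.infinitePi fun _ : ℕ => ν) :=
    iIndepFun_infinitePi (X := fun _ x => x) fun _ => measurable_id
  filter_upwards [ae_frequently_lt (fun n => measurable_pi_apply n) hind (a := a) hp fun n => by
    have := Measure.infinitePi_map_eval (fun _ : ℕ => ν) n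
    rw [← this, Measure.map_apply (measurable_pi_apply n) measurableSet_Ioi]
    exact le_of_eq (by congr 1; rw [this])] with s hs
  exact hs.exists

/-- Condition on the first gap: a short one reproduces the same unknown, weighted by a truncated
characteristic function; a long one completes a cycle and leaves `k` pairs of sojourns. -/
theorem sojournChar_succ_eq_add (ν : Measure ℝ) [IsProbabilityMeasure ν] {a : ℝ}
    (hp : ν (Set.Ioi a) ≠ 0) (k : ℕ) (ξ : ℕ → ℝ) :
    sojournChar ν a (k + 1) ξ =
      (∫ u in Set.Iic a, Complex.exp (((ξ 0 * u : ℝ) : ℂ) * Complex.I) ∂ν) *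
        sojournChar ν a (k + 1) ξ +
      Complex.exp (((ξ 0 * a : ℝ) : ℂ) * Complex.I) *
        (∫ u in Set.Ioi a, Complex.exp (((ξ 1 * (u - a) : ℝ) : ℂ) * Complex.I) ∂ν) *
        sojournChar ν a k fun j => ξ (j + 2) := by
  set μ := Measure.infinitePi fun _ : ℕ => ν with hμ
  have hsm := measurable_sojourn a
  set E1 : (ℕ → ℝ) → ℂ := fun s => Complex.exp
    (((∑ j ∈ Finset.range (2 * (k + 1)), ξ j * sojourn a j s : ℝ) : ℂ) * Complex.I) with hE1
  set E0 : (ℕ → ℝ) → ℂ := fun s => Complex.exp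
    (((∑ j ∈ Finset.range (2 * k), ξ (j + 2) * sojourn a j s : ℝ) : ℂ) * Complex.I) with hE0
  set A : ℝ → ℂ := (Set.Iic a).indicator fun u =>
    Complex.exp (((ξ 0 * u : ℝ) : ℂ) * Complex.I) with hA
  set B : ℝ → ℂ := (Set.Ioi a).indicator fun u => Complex.exp (((ξ 0 * a : ℝ) : ℂ) * Complex.I) *
    Complex.exp (((ξ 1 * (u - a) : ℝ) : ℂ) * Complex.I) with hB
  have hE1m : Measurable fun s => ∑ j ∈ Finset.range (2 * (k + 1)), ξ j * sojourn a j s := by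
    fun_prop
  have hE0m : Measurable fun s => ∑ j ∈ Finset.range (2 * k), ξ (j + 2) * sojourn a j s := by
    fun_prop
  have hE1i : Integrable E1 μ := integrable_exp_ofReal_mul_I hE1m
  have hE0i : Integrable E0 μ := integrable_exp_ofReal_mul_I hE0m
  have hAi : Integrable A ν :=
    (integrable_exp_ofReal_mul_I (by fun_prop)).indicator measurableSet_Iic
  have hBi : Integrable B ν :=
    ((integrable_exp_ofReal_mul_I (by fun_prop)).const_mul _).indicator measurableSet_Ioi
  have hstep : ∀ᵐ p ∂(ν.prod μ), E1 (seqCons p.1 p.2) = A p.1 * E1 p.2 + B p.1 * E0 p.2 := by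
    -- Without a later gap longer than `a`, `firstExceed` takes its default value `0` and the
    -- identity for a short first gap can fail.
    have hq : ∀ᵐ p ∂(ν.prod μ), ∃ n, a < p.2 n :=
      Measure.quasiMeasurePreserving_snd.ae (ae_infinitePi_exists_lt hp)
    filter_upwards [hq] with p hs
    rcases le_or_gt p.1 a with h | h
    · rw [hA, hB, Set.indicator_of_mem (Set.mem_Iic.2 h), Set.indicator_of_notMem (by simpa using h),
        zero_mul, add_zero]
      simp only [hE1]
      rw [sum_sojourn_seqCons_of_le h hs, ← Complex.exp_add]
      push_cast
      ring_nf
    · rw [hA, hB, Set.indicator_of_notMem (by simpa using h), Set.indicator_of_mem (Set.mem_Ioi.2 h),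
        zero_mul, zero_add]
      simp only [hE1, hE0]
      rw [sum_sojourn_seqCons_of_lt h, ← Complex.exp_add, ← Complex.exp_add]
      push_cast
      ring_nf
  have hint : ∫ s, E1 s ∂μ = ∫ p, E1 (seqCons p.1 p.2) ∂(ν.prod μ) := by
    conv_lhs => rw [hμ, ← map_seqCons_prod_infinitePi ν]
    rw [integral_map measurable_seqCons.aemeasurable]
    exact (by fun_prop : Measurable E1).aestronglyMeasurable
  change ∫ s, E1 s ∂μ = _ * (∫ s, E1 s ∂μ) + _ * (∫ s, E0 s ∂μ)
  conv_lhs => rw [hint, integral_congr_ae hstep, integral_add (hAi.mul_prod hE1i) (hBi.mul_prod hE0i),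
    integral_prod_mul, integral_prod_mul]
  rw [hA, hB, integral_indicator measurableSet_Iic, integral_indicator measurableSet_Ioi,
    integral_const_mul]

/-! ### Characteristic functions from tails -/

theorem exp_sub_one_eq_setIntegral (ξ : ℝ) {v : ℝ} (hv : 0 ≤ v) :
    Complex.exp (((ξ * v : ℝ) : ℂ) * Complex.I) - 1 =
      (ξ : ℂ) * Complex.I * ∫ t in Set.Ioi (0 : ℝ), (Set.Iio v).indicator
        (fun t => Complex.exp (((ξ * t : ℝ) : ℂ) * Complex.I)) t := by
  have hd : ∀ t : ℝ, HasDerivAt (fun t : ℝ => Complex.exp (((ξ * t : ℝ) : ℂ) * Complex.I))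
      ((ξ : ℂ) * Complex.I * Complex.exp (((ξ * t : ℝ) : ℂ) * Complex.I)) t := fun t => by
    have h1 : HasDerivAt (fun t : ℝ => ((ξ * t : ℝ) : ℂ) * Complex.I) ((ξ : ℂ) * Complex.I) t := by
      have := ((hasDerivAt_id t).const_mul ξ).ofReal_comp.mul_const Complex.I
      simpa using this
    have := h1.cexp
    rwa [mul_comm] at this
  have hftc := intervalIntegral.integral_eq_sub_of_hasDerivAt (a := 0) (b := v) (fun t _ => hd t)
    (Continuous.intervalIntegrable (by fun_prop) _ _)
  rw [intervalIntegral.integral_const_mul] at hftc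
  simp only [mul_zero, Complex.ofReal_zero, zero_mul, Complex.exp_zero] at hftc
  rw [← hftc, intervalIntegral.integral_of_le hv, integral_indicator measurableSet_Iio,
    Measure.restrict_restrict measurableSet_Iio, integral_Ioc_eq_integral_Ioo]
  congr 2
  congr 1
  ext t
  simp [and_comm]

/-- Layer-cake formula: write `e^{iξY} - 1` as an integral over `[0, Y)` and apply Fubini. The
measure need not have mass one, since the formula is also used for the law of a gap restricted to
`(a, ∞)`. -/
theorem integral_exp_eq_add_setIntegral_tail {α : Type*} [MeasurableSpace α] {μ : Measure α}
    [IsFiniteMeasure μ] {Y : α → ℝ} (hY : Measurable Y) (h0 : ∀ᵐ x ∂μ, 0 ≤ Y x)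
    (hint : IntegrableOn (fun t => μ.real {x | t < Y x}) (Set.Ioi 0)) (ξ : ℝ) :
    ∫ x, Complex.exp (((ξ * Y x : ℝ) : ℂ) * Complex.I) ∂μ = μ.real Set.univ +
      (ξ : ℂ) * Complex.I * ∫ t in Set.Ioi (0 : ℝ),
        Complex.exp (((ξ * t : ℝ) : ℂ) * Complex.I) * μ.real {x | t < Y x} := by
  set g : α → ℝ → ℂ := fun x t => (Set.Iio (Y x)).indicator
        (fun t => Complex.exp (((ξ * t : ℝ) : ℂ) * Complex.I)) t with hg
  have hgm : Measurable (Function.uncurry g) := by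
    have : Function.uncurry g = {p : α × ℝ | p.2 < Y p.1}.indicator
        fun p => Complex.exp (((ξ * p.2 : ℝ) : ℂ) * Complex.I) := by
      ext p
      simp [Function.uncurry, hg, Set.indicator]
    rw [this]
    exact Measurable.indicator (by fun_prop)
      (measurableSet_lt measurable_snd (hY.comp measurable_fst))
  have hset : ∀ t, MeasurableSet {x | t < Y x} := fun t => measurableSet_lt measurable_const hY
  have hgt : ∀ t, (fun x => g x t) = {x | t < Y x}.indicator
      fun _ => Complex.exp (((ξ * t : ℝ) : ℂ) * Complex.I) := fun t => by
    ext x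
    simp [hg, Set.indicator]
  have hinner : ∀ t, ∫ x, g x t ∂μ =
      Complex.exp (((ξ * t : ℝ) : ℂ) * Complex.I) * μ.real {x | t < Y x} := fun t => by
    rw [hgt, integral_indicator_const _ (hset t), Complex.real_smul, mul_comm]
  have hnorm : ∀ t, ∫ x, ‖g x t‖ ∂μ = μ.real {x | t < Y x} := fun t => by
    have : (fun x => ‖g x t‖) = {x | t < Y x}.indicator fun _ => (1 : ℝ) := by
      ext x
      rw [congrFun (hgt t) x, norm_indicator_eq_indicator_norm]
      simp only [Complex.norm_exp_ofReal_mul_I]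
    rw [this, integral_indicator_const _ (hset t), smul_eq_mul, mul_one]
  have hgi : Integrable (Function.uncurry g) (μ.prod (volume.restrict (Set.Ioi 0))) := by
    rw [integrable_prod_iff' hgm.aestronglyMeasurable]
    constructor
    · refine Eventually.of_forall fun t => ?_
      change Integrable (fun x => g x t) μ
      rw [hgt]
      exact (integrable_const _).indicator (hset t)
    · exact hint.congr (Eventually.of_forall fun t => (hnorm t).symm)
  have hpt : ∀ᵐ x ∂μ, Complex.exp (((ξ * Y x : ℝ) : ℂ) * Complex.I) =
      1 + (ξ : ℂ) * Complex.I * ∫ t in Set.Ioi (0 : ℝ), g x t := by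
    filter_upwards [h0] with x hx
    rw [← exp_sub_one_eq_setIntegral ξ hx]
    ring
  have hgl : Integrable (fun x => ∫ t in Set.Ioi (0 : ℝ), g x t) μ := hgi.integral_prod_left
  rw [integral_congr_ae hpt, integral_add (integrable_const _) (hgl.const_mul _),
    integral_const_mul, integral_integral_swap hgi]
  simp only [hinner]
  simp

/-! ### The flow -/

namespace IsResettingPair

variable {f h : ℝ → ℝ}

theorem exists_abs_sub_le (hfh : IsResettingPair f h) :
    ∃ L, 0 < L ∧ ∀ u ∈ Set.Icc (0 : ℝ) 1, |f u - f 0| ≤ L * u := by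
  obtain ⟨K, hK⟩ := hfh.contDiffOn_f.exists_lipschitzOnWith two_ne_zero (convex_Icc 0 1)
    isCompact_Icc
  refine ⟨K + 1, by positivity, fun u hu => ?_⟩
  have := hK.dist_le_mul u hu 0 ⟨le_rfl, zero_le_one⟩
  rw [Real.dist_eq, Real.dist_eq, sub_zero, abs_of_nonneg hu.1] at this
  linarith [hu.1]

theorem exists_abs_le (hfh : IsResettingPair f h) :
    ∃ M, 0 < M ∧ ∀ u ∈ Set.Icc (0 : ℝ) 1, |f u| ≤ M := by
  obtain ⟨C, hC⟩ := isCompact_Icc.exists_bound_of_continuousOn hfh.contDiffOn_f.continuousOn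
  exact ⟨|C| + 1, by positivity, fun u hu => (hC u hu).trans ((le_abs_self C).trans (by linarith))⟩

/-- As `h` is positive to the left of its zero `1`, the nonzero derivative there is negative, which
gives a linear lower bound near `1`; away from `1`, compactness bounds `h` below. -/
theorem exists_mul_one_sub_le (hfh : IsResettingPair f h) :
    ∃ c, 0 < c ∧ ∀ u ∈ Set.Icc (0 : ℝ) 1, c * (1 - u) ≤ h u := by
  set h' := derivWithin h (Set.Icc 0 1) 1 with hh'
  have hd : HasDerivWithinAt h h' (Set.Icc 0 1) 1 :=
    ((hfh.contDiffOn_h.differentiableOn (by norm_num)) 1 ⟨zero_le_one, le_rfl⟩).hasDerivWithinAt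
  have hs : Tendsto (slope h 1) (𝓝[Set.Ico 0 1] 1) (𝓝 h') := by
    rw [← hasDerivWithinAt_iff_tendsto_slope' (by simp)]
    exact hd.mono Set.Ico_subset_Icc_self
  have hslope : ∀ u, slope h 1 u = h u / (u - 1) := fun u => by
    rw [slope_def_field, hfh.h_one, sub_zero]
  have hne : (𝓝[Set.Ico (0 : ℝ) 1] 1).NeBot := by
    rw [nhdsWithin_Ico_eq_nhdsLT zero_lt_one]
    infer_instance
  have hle : h' ≤ 0 := by
    refine le_of_tendsto hs ?_
    filter_upwards [self_mem_nhdsWithin] with u hu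
    rw [hslope]
    exact div_nonpos_of_nonneg_of_nonpos (hfh.h_pos u hu).le (by linarith [hu.2])
  have hlt : h' < 0 := lt_of_le_of_ne hle hfh.deriv_h_one
  have hev : ∀ᶠ u in 𝓝[Set.Ico (0 : ℝ) 1] 1, slope h 1 u < h' / 2 :=
    hs.eventually_lt_const (by linarith)
  rw [nhdsWithin_Ico_eq_nhdsLT zero_lt_one] at hev
  obtain ⟨l, hl, hl'⟩ := (mem_nhdsLT_iff_exists_mem_Ico_Ioo_subset (zero_lt_one (α := ℝ))).1 hev
  have hcont : ContinuousOn h (Set.Icc 0 l) :=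
    hfh.contDiffOn_h.continuousOn.mono (Set.Icc_subset_Icc_right hl.2.le)
  obtain ⟨v, hv, hvmin⟩ := isCompact_Icc.exists_isMinOn (Set.nonempty_Icc.2 hl.1) hcont
  have hvpos : 0 < h v := hfh.h_pos v ⟨hv.1, hv.2.trans_lt hl.2⟩
  refine ⟨min (-h' / 2) (h v), lt_min (by linarith) hvpos, fun u hu => ?_⟩
  have hu0 : 0 ≤ 1 - u := by linarith [hu.2]
  rcases eq_or_lt_of_le hu.2 with rfl | hu1
  · simp [hfh.h_one]
  rcases le_or_gt u l with hul | hul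
  · calc _ ≤ h v * (1 - u) := by gcongr; exact min_le_right _ _
      _ ≤ h v * 1 := by gcongr; linarith [hu.1]
      _ ≤ h u := by rw [mul_one]; exact hvmin ⟨hu.1, hul⟩
  · have h1 : slope h 1 u < h' / 2 := hl' ⟨hul, hu1⟩
    rw [hslope, div_lt_iff_of_neg (by linarith)] at h1
    calc _ ≤ -h' / 2 * (1 - u) := by gcongr; exact min_le_left _ _
      _ ≤ h u := by linarith

end IsResettingPair

namespace IsFlow

variable {f h : ℝ → ℝ} {ε : ℝ} {x : ℝ → ℝ}

theorem continuousOn (hx : IsFlow f h ε x) : ContinuousOn x (Set.Ici 0) :=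
  fun t ht => (hx.ode t ht).continuousWithinAt

theorem hasDerivAt (hx : IsFlow f h ε x) {t : ℝ} (ht : 0 < t) :
    HasDerivAt x (ε⁻¹ * (ε * f (x t) + x t * h (x t))) t :=
  (hx.ode t ht.le).hasDerivAt (Ici_mem_nhds ht)

/-- An equilibrium is not reached in finite time: by uniqueness the flow would be constant on `[0,
T]`, hence equal to `0`, where the drift is `f 0 ≠ 0`. -/
theorem drift_ne_zero (hfh : IsResettingPair f h) (hε : 0 < ε) (hx : IsFlow f h ε x) {T : ℝ}
    (hT : 0 ≤ T) : ε⁻¹ * (ε * f (x T) + x T * h (x T)) ≠ 0 := by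
  intro h0
  let F : ℝ → ℝ := fun u => ε⁻¹ * (ε * f u + u * h u)
  have hF : ContDiffOn ℝ 2 F (Set.Icc 0 1) :=
    contDiffOn_const.mul ((contDiffOn_const.mul hfh.contDiffOn_f).add
      (contDiffOn_id.mul hfh.contDiffOn_h))
  obtain ⟨K, hK⟩ := hF.exists_lipschitzOnWith two_ne_zero (convex_Icc 0 1) isCompact_Icc
  have hEq : Set.EqOn x (fun _ => x T) (Set.Icc 0 T) := by
    refine ODE_solution_unique_of_mem_Icc_left (v := fun _ => F) (K := K)
      (s := fun _ => Set.Icc 0 1) (fun _ _ => hK)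
      (hx.continuousOn.mono fun t ht => ht.1) (fun t ht => (hx.hasDerivAt ht.1).hasDerivWithinAt)
      (fun t ht => hx.mem_Icc t ht.1.le) continuousOn_const (fun t ht => ?_)
      (fun t ht => hx.mem_Icc T hT) rfl
    change HasDerivWithinAt (fun _ => x T) (F (x T)) _ _
    rw [show F (x T) = 0 from h0]
    exact hasDerivWithinAt_const ..
  have h1 : x T = 0 := by
    have h2 : x 0 = x T := hEq ⟨le_rfl, hT⟩
    rw [← h2, hx.init]
  rw [h1, zero_mul, add_zero, inv_mul_cancel_left₀ hε.ne'] at h0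
  exact hfh.f_zero_pos.ne' h0

theorem continuousOn_drift (hfh : IsResettingPair f h) (hx : IsFlow f h ε x) :
    ContinuousOn (fun t => ε⁻¹ * (ε * f (x t) + x t * h (x t))) (Set.Ici 0) := by
  have hf := hfh.contDiffOn_f.continuousOn.comp hx.continuousOn fun t ht => hx.mem_Icc t ht
  have hh := hfh.contDiffOn_h.continuousOn.comp hx.continuousOn fun t ht => hx.mem_Icc t ht
  exact continuousOn_const.mul ((continuousOn_const.mul hf).add (hx.continuousOn.mul hh))

theorem drift_pos (hfh : IsResettingPair f h) (hε : 0 < ε) (hx : IsFlow f h ε x) {T : ℝ}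
    (hT : 0 ≤ T) : 0 < ε⁻¹ * (ε * f (x T) + x T * h (x T)) := by
  by_contra hneg
  have h0 : 0 ≤ ε⁻¹ * (ε * f (x 0) + x 0 * h (x 0)) := by
    rw [hx.init, zero_mul, add_zero, inv_mul_cancel_left₀ hε.ne']
    exact hfh.f_zero_pos.le
  obtain ⟨t, ht, ht'⟩ := intermediate_value_Icc' hT
    ((hx.continuousOn_drift hfh).mono fun t ht => ht.1) ⟨not_lt.1 hneg, h0⟩
  exact hx.drift_ne_zero hfh hε ht.1 ht'

theorem strictMonoOn (hfh : IsResettingPair f h) (hε : 0 < ε) (hx : IsFlow f h ε x) :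
    StrictMonoOn x (Set.Ici 0) := by
  refine strictMonoOn_of_deriv_pos (convex_Ici 0) hx.continuousOn fun t ht => ?_
  rw [interior_Ici] at ht
  rw [(hx.hasDerivAt ht).deriv]
  exact hx.drift_pos hfh hε (le_of_lt ht)

theorem eq_zero_iff (hfh : IsResettingPair f h) (hε : 0 < ε) (hx : IsFlow f h ε x) {t : ℝ}
    (ht : 0 ≤ t) : x t = 0 ↔ t = 0 := by
  constructor
  · intro h0
    by_contra hne
    have := hx.strictMonoOn hfh hε Set.self_mem_Ici ht (lt_of_le_of_ne ht (Ne.symm hne))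
    rw [hx.init, h0] at this
    exact lt_irrefl _ this
  · rintro rfl
    exact hx.init

theorem exists_hitting (hfh : IsResettingPair f h) (hε : 0 < ε) (hx : IsFlow f h ε x) {y T : ℝ}
    (hy : 0 < y) (hT : 0 ≤ T) (hyT : y ≤ x T) :
    ∃ a, 0 < a ∧ a ≤ T ∧ x a = y ∧ ∀ t, 0 ≤ t → (y < x t ↔ a < t) := by
  obtain ⟨a, ha, hay⟩ := intermediate_value_Icc hT (hx.continuousOn.mono fun t ht => ht.1)
    (show y ∈ Set.Icc (x 0) (x T) from ⟨by rw [hx.init]; exact hy.le, hyT⟩)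
  refine ⟨a, lt_of_le_of_ne ha.1 ?_, ha.2, hay, fun t ht => ?_⟩
  · rintro rfl
    rw [hx.init] at hay
    exact hy.ne hay
  · rw [← hay]
    exact (hx.strictMonoOn hfh hε).lt_iff_lt ha.1 ht

/-! ### Speed of the flow -/

/-- As long as the flow has not passed `u₁`, its speed is at least `m`, so `x t - m * t` does not
decrease. -/
theorem le_of_drift_ge (hfh : IsResettingPair f h) (hε : 0 < ε) (hx : IsFlow f h ε x)
    {u₀ u₁ m t₀ : ℝ} (hm : 0 < m) (hu : u₀ ≤ u₁) (ht₀ : 0 ≤ t₀) (hxt : u₀ ≤ x t₀)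
    (hF : ∀ u, 0 ≤ u → u₀ ≤ u → u ≤ u₁ → m ≤ f u + ε⁻¹ * (u * h u)) :
    u₁ ≤ x (t₀ + (u₁ - u₀) / m) := by
  set T := t₀ + (u₁ - u₀) / m with hT
  have hT0 : t₀ ≤ T := by
    have : 0 ≤ (u₁ - u₀) / m := div_nonneg (by linarith) hm.le
    linarith
  by_contra! hlt
  have hmono := (hx.strictMonoOn hfh hε).monotoneOn
  have hsub : MonotoneOn (fun t => x t - m * t) (Set.Icc t₀ T) := by
    refine monotoneOn_of_deriv_nonneg (convex_Icc _ _)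
      ((hx.continuousOn.mono fun t ht => ht₀.trans ht.1).sub (by fun_prop)) ?_ ?_
    · intro t ht
      rw [interior_Icc] at ht
      exact ((hx.hasDerivAt (ht₀.trans_lt ht.1)).differentiableAt.sub
        (by fun_prop)).differentiableWithinAt
    · intro t ht
      rw [interior_Icc] at ht
      have ht0 : 0 < t := ht₀.trans_lt ht.1
      have hd : HasDerivAt (fun t => x t - m * t) _ t :=
        (hx.hasDerivAt ht0).sub ((hasDerivAt_id t).const_mul m)
      rw [hd.deriv, mul_one, mul_add, inv_mul_cancel_left₀ hε.ne', sub_nonneg]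
      exact hF _ (hx.mem_Icc t ht0.le).1 (hxt.trans (hmono ht₀ ht0.le ht.1.le))
        ((hmono ht0.le (ht₀.trans hT0) ht.2.le).trans hlt.le)
  have := hsub (Set.left_mem_Icc.2 hT0) (Set.right_mem_Icc.2 hT0) hT0
  have hmT : m * T = m * t₀ + (u₁ - u₀) := by
    rw [hT]
    field_simp
  simp only at this
  linarith

end IsFlow

/-- Two phases. Up to `√ε` the speed is at least `f 0 / 2`. From `√ε` to `1 - ε ^ β` the fast term
is at least `c / (2√ε)`, half of which absorbs `-M ≤ f`, leaving speed `c / (4√ε)`. The durations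
are at most `2√ε / f 0` and `4√ε / c`. -/
theorem IsResettingPair.exists_hitting_le {f h : ℝ → ℝ} (hfh : IsResettingPair f h) {β : ℝ}
    (hβ : β ∈ Set.Ioo (0 : ℝ) (1 / 2)) : ∃ C, ∀ᶠ ε in 𝓝[>] (0 : ℝ), ∀ x, IsFlow f h ε x →
      0 ≤ C * √ε ∧ 1 - ε ^ β ≤ x (C * √ε) := by
  obtain ⟨L, hL, hLf⟩ := hfh.exists_abs_sub_le
  obtain ⟨M, hM, hMf⟩ := hfh.exists_abs_le
  obtain ⟨c, hc, hch⟩ := hfh.exists_mul_one_sub_le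
  have hf0 := hfh.f_zero_pos
  refine ⟨2 / f 0 + 4 / c, ?_⟩
  have hsq : Tendsto (fun ε : ℝ => √ε) (𝓝[>] 0) (𝓝 0) := by
    have := (Real.continuous_sqrt.tendsto 0).mono_left (nhdsWithin_le_nhds (s := Set.Ioi 0))
    rwa [Real.sqrt_zero] at this
  have hpow : Tendsto (fun ε : ℝ => ε ^ β) (𝓝[>] 0) (𝓝 0) := by
    have := (Real.continuousAt_rpow_const 0 β (Or.inr hβ.1.le)).tendsto.mono_left
      (nhdsWithin_le_nhds (s := Set.Ioi 0))
    rwa [Real.zero_rpow hβ.1.ne'] at this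
  have e1 : ∀ᶠ ε : ℝ in 𝓝[>] 0, √ε < f 0 / (2 * L) := hsq.eventually_lt_const (by positivity)
  have e2 : ∀ᶠ ε : ℝ in 𝓝[>] 0, √ε < 1 / 2 := hsq.eventually_lt_const (by norm_num)
  have e3 : ∀ᶠ ε : ℝ in 𝓝[>] 0, ε ^ β < 1 / 2 := hpow.eventually_lt_const (by norm_num)
  have e4 : ∀ᶠ ε : ℝ in 𝓝[>] 0, √ε < c / (4 * M) := hsq.eventually_lt_const (by positivity)
  filter_upwards [e1, e2, e3, e4, self_mem_nhdsWithin] with ε h1 h2 h3 h4 hε x hx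
  have hε0 : (0 : ℝ) < ε := hε
  set r := √ε with hr
  have hr0 : 0 < r := Real.sqrt_pos.2 hε0
  have hrε : r * r = ε := Real.mul_self_sqrt hε0.le
  have hε1 : ε ≤ 1 := by nlinarith
  -- The bound `β < 1/2` enters here: it puts the upper level at distance at least `√ε` from `1`.
  have hrβ : r ≤ ε ^ β := by
    rw [hr, Real.sqrt_eq_rpow]
    exact Real.rpow_le_rpow_of_exponent_ge hε0 hε1 hβ.2.le
  refine ⟨by positivity, ?_⟩
  have p1 : r ≤ x (0 + (r - 0) / (f 0 / 2)) := by
    refine hx.le_of_drift_ge hfh hε0 (by positivity) hr0.le le_rfl (by rw [hx.init])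
      fun u hu _ hur => ?_
    have hu1 : u ∈ Set.Icc (0 : ℝ) 1 := ⟨hu, by linarith⟩
    have a1 := (abs_le.1 (hLf u hu1)).1
    have a2 : 0 ≤ h u := le_trans (mul_nonneg hc.le (by linarith [hu1.2])) (hch u hu1)
    have a3 : L * u ≤ f 0 / 2 := by
      rw [lt_div_iff₀ (by positivity)] at h1
      nlinarith
    have a4 : 0 ≤ ε⁻¹ * (u * h u) := by positivity
    linarith
  have hm : 0 < c / (4 * r) := by positivity
  have p2 : 1 - ε ^ β ≤ x (0 + (r - 0) / (f 0 / 2) + (1 - ε ^ β - r) / (c / (4 * r))) := by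
    refine hx.le_of_drift_ge hfh hε0 hm (by linarith) (by positivity) p1 fun u hu hru huy => ?_
    have hu1 : u ∈ Set.Icc (0 : ℝ) 1 := ⟨hu, by linarith⟩
    have a1 := (abs_le.1 (hMf u hu1)).1
    have a2 := hch u hu1
    -- Both `u` and `1 - u` are at least `r`, and one of them is at least `1/2`.
    have a3 : r / 2 ≤ u * (1 - u) := by
      rcases le_total u (1 / 2) with h | h
      · nlinarith
      · nlinarith
    have a4 : c * (r / 2) ≤ u * h u := by
      calc c * (r / 2) ≤ c * (u * (1 - u)) := by gcongr
        _ = u * (c * (1 - u)) := by ring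
        _ ≤ u * h u := by gcongr
    have a5 : ε⁻¹ * (c * (r / 2)) ≤ ε⁻¹ * (u * h u) := by gcongr
    have a6 : ε⁻¹ * (c * (r / 2)) = 2 * (c / (4 * r)) := by
      rw [← hrε]
      field_simp
      ring
    have a7 : M ≤ c / (4 * r) := by
      rw [lt_div_iff₀ (by positivity)] at h4
      rw [le_div_iff₀ (by positivity)]
      linarith
    linarith
  refine p2.trans ((hx.strictMonoOn hfh hε0).monotoneOn ?_ ?_ ?_)
  · have : 0 ≤ (1 - ε ^ β - r) / (c / (4 * r)) := div_nonneg (by linarith) hm.le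
    exact Set.mem_Ici.2 (by positivity)
  · exact Set.mem_Ici.2 (by positivity)
  · have : (1 - ε ^ β - r) / (c / (4 * r)) ≤ 1 / (c / (4 * r)) := by
      gcongr
      linarith [Real.rpow_nonneg hε0.le β]
    have e : (2 / f 0 + 4 / c) * r = 0 + (r - 0) / (f 0 / 2) + 1 / (c / (4 * r)) := by
      field_simp
      ring
    rw [e]
    gcongr

/-! ### The survival function of the gaps -/

/-- The probability that there is no reset before time `t`. -/
noncomputable def survival (h : ℝ → ℝ) (ε : ℝ) (x : ℝ → ℝ) (t : ℝ) : ℝ :=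
  Real.exp (-(ε⁻¹ * ∫ s in (0 : ℝ)..t, h (x s)))

theorem survival_pos (h : ℝ → ℝ) (ε : ℝ) (x : ℝ → ℝ) (t : ℝ) : 0 < survival h ε x t :=
  Real.exp_pos _

theorem survival_zero (h : ℝ → ℝ) (ε : ℝ) (x : ℝ → ℝ) : survival h ε x 0 = 1 := by
  simp [survival]

namespace IsFlow

variable {f h : ℝ → ℝ} {ε : ℝ} {x : ℝ → ℝ}

theorem hasDerivWithinAt_survival (hfh : IsResettingPair f h) (hx : IsFlow f h ε x) {t : ℝ}
    (ht : 0 ≤ t) : HasDerivWithinAt (survival h ε x)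
      (-(ε⁻¹ * h (x t)) * survival h ε x t) (Set.Ici 0) t := by
  -- Freezing the flow at negative times gives a continuous integrand on all of `ℝ`, as the
  -- fundamental theorem of calculus at `t = 0` requires.
  have hk : Continuous fun s => h (x (max s 0)) := by
    have h1 : ContinuousOn (fun s => h (x s)) (Set.Ici 0) :=
      hfh.contDiffOn_h.continuousOn.comp hx.continuousOn fun t ht => hx.mem_Icc t ht
    exact h1.comp_continuous (by fun_prop) fun s => Set.mem_Ici.2 (le_max_right _ _)
  have heq : ∀ s ∈ Set.Ici (0 : ℝ), survival h ε x s =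
      Real.exp (-(ε⁻¹ * ∫ r in (0 : ℝ)..s, h (x (max r 0)))) := fun s hs => by
    rw [survival]
    congr 3
    refine intervalIntegral.integral_congr fun r hr => ?_
    rw [Set.uIcc_of_le hs] at hr
    simp only [max_eq_left hr.1]
  have hd : HasDerivAt (fun s => Real.exp (-(ε⁻¹ * ∫ r in (0 : ℝ)..s, h (x (max r 0)))))
      (Real.exp (-(ε⁻¹ * ∫ r in (0 : ℝ)..t, h (x (max r 0)))) * -(ε⁻¹ * h (x (max t 0)))) t :=
    ((hk.integral_hasStrictDerivAt 0 t).hasDerivAt.const_mul ε⁻¹).neg.exp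
  have := hd.hasDerivWithinAt.congr (s := Set.Ici 0) heq (heq t ht)
  rwa [← heq t ht, max_eq_left ht, mul_comm] at this

/-- The gain `x h(x)/ε` of the flow cancels the loss of the survival function at rate `h(x)/ε`. This
identity drives both limits. -/
theorem hasDerivWithinAt_mul_survival (hfh : IsResettingPair f h) (hε : 0 < ε)
    (hx : IsFlow f h ε x) {t : ℝ} (ht : 0 ≤ t) :
    HasDerivWithinAt (fun t => x t * survival h ε x t) (f (x t) * survival h ε x t)
      (Set.Ici 0) t := by
  refine ((hx.ode t ht).mul (hx.hasDerivWithinAt_survival hfh ht)).congr_deriv ?_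
  field_simp
  ring

theorem continuousOn_survival (hfh : IsResettingPair f h) (hx : IsFlow f h ε x) :
    ContinuousOn (survival h ε x) (Set.Ici 0) :=
  fun _ ht => (hx.hasDerivWithinAt_survival hfh ht).continuousWithinAt

theorem continuousOn_comp_mul_survival (hfh : IsResettingPair f h) (hx : IsFlow f h ε x) :
    ContinuousOn (fun t => f (x t) * survival h ε x t) (Set.Ici 0) :=
  (hfh.contDiffOn_f.continuousOn.comp hx.continuousOn fun t ht => hx.mem_Icc t ht).mul
    (hx.continuousOn_survival hfh)

theorem integral_comp_mul_survival (hfh : IsResettingPair f h) (hε : 0 < ε)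
    (hx : IsFlow f h ε x) {a : ℝ} (ha : 0 ≤ a) :
    ∫ s in (0 : ℝ)..a, f (x s) * survival h ε x s = x a * survival h ε x a := by
  have hsub : Set.Icc 0 a ⊆ Set.Ici 0 := fun t ht => ht.1
  rw [intervalIntegral.integral_eq_sub_of_hasDeriv_right_of_le ha
    (f := fun t => x t * survival h ε x t)
    (fun t ht => ((hx.hasDerivWithinAt_mul_survival hfh hε ht.1).continuousWithinAt).mono hsub)
    (fun t ht => (hx.hasDerivWithinAt_mul_survival hfh hε ht.1.le).mono
      fun s hs => ht.1.le.trans (le_of_lt hs)), hx.init, zero_mul, sub_zero]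
  exact ((hx.continuousOn_comp_mul_survival hfh).mono (by rwa [Set.uIcc_of_le ha])).intervalIntegrable

theorem intervalIntegrable_survival (hfh : IsResettingPair f h) (hx : IsFlow f h ε x) {a b : ℝ}
    (ha : 0 ≤ a) (hb : 0 ≤ b) : IntervalIntegrable (survival h ε x) volume a b :=
  ((hx.continuousOn_survival hfh).mono fun _ ht => (le_min ha hb).trans ht.1).intervalIntegrable

/-- Bootstrap of `integral_comp_mul_survival`: with `|f| ≤ M` it bounds `xG` by `M ∫G`; the error
`|f(x) - f(0)| G ≤ L x G` is then at most `L M ∫G`, and is integrated over a length `a`. -/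
theorem abs_mul_survival_sub_le (hfh : IsResettingPair f h) (hε : 0 < ε) (hx : IsFlow f h ε x)
    {L M : ℝ} (hL : 0 ≤ L) (hLf : ∀ u ∈ Set.Icc (0 : ℝ) 1, |f u - f 0| ≤ L * u)
    (hMf : ∀ u ∈ Set.Icc (0 : ℝ) 1, |f u| ≤ M) {a : ℝ} (ha : 0 ≤ a) :
    |x a * survival h ε x a - f 0 * ∫ s in (0 : ℝ)..a, survival h ε x s| ≤
      L * M * a * ∫ s in (0 : ℝ)..a, survival h ε x s := by
  set J := ∫ s in (0 : ℝ)..a, survival h ε x s with hJ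
  have hM : 0 ≤ M := (abs_nonneg _).trans (hMf 0 ⟨le_rfl, zero_le_one⟩)
  have hW : ∀ s ∈ Set.Icc 0 a, x s * survival h ε x s ≤ M * J := fun s hs => by
    rw [← hx.integral_comp_mul_survival hfh hε hs.1]
    calc _ ≤ ∫ r in (0 : ℝ)..s, M * survival h ε x r := by
          refine intervalIntegral.integral_mono_on hs.1 ?_
            ((hx.intervalIntegrable_survival hfh le_rfl hs.1).const_mul M) fun r hr => ?_
          · exact ((hx.continuousOn_comp_mul_survival hfh).mono
              (by rw [Set.uIcc_of_le hs.1]; exact fun t ht => ht.1)).intervalIntegrable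
          · exact mul_le_mul_of_nonneg_right ((le_abs_self _).trans (hMf _ (hx.mem_Icc r hr.1)))
              (survival_pos ..).le
      _ = M * ∫ r in (0 : ℝ)..s, survival h ε x r := intervalIntegral.integral_const_mul _ _
      _ ≤ M * J := by
          refine mul_le_mul_of_nonneg_left ?_ hM
          exact intervalIntegral.integral_mono_interval le_rfl hs.1 hs.2
            (Eventually.of_forall fun r => (survival_pos ..).le)
            (hx.intervalIntegrable_survival hfh le_rfl ha)
  have hint1 : IntervalIntegrable (fun s => f (x s) * survival h ε x s) volume 0 a :=
    ((hx.continuousOn_comp_mul_survival hfh).mono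
      (by rw [Set.uIcc_of_le ha]; exact fun t ht => ht.1)).intervalIntegrable
  rw [← hx.integral_comp_mul_survival hfh hε ha, hJ, ← intervalIntegral.integral_const_mul,
    ← intervalIntegral.integral_sub hint1 ((hx.intervalIntegrable_survival hfh le_rfl ha).const_mul _),
    ← Real.norm_eq_abs, ← hJ]
  have := intervalIntegral.norm_integral_le_of_norm_le_const (a := 0) (b := a) (C := L * M * J)
    (f := fun s => f (x s) * survival h ε x s - f 0 * survival h ε x s) fun s hs => by
      rw [Set.uIoc_of_le ha] at hs
      have hG := survival_pos h ε x s
      rw [← sub_mul, Real.norm_eq_abs, abs_mul, abs_of_pos hG]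
      calc _ ≤ L * x s * survival h ε x s := by gcongr; exact hLf _ (hx.mem_Icc s hs.1.le)
        _ = L * (x s * survival h ε x s) := by ring
        _ ≤ L * (M * J) := mul_le_mul_of_nonneg_left (hW s ⟨hs.1.le, hs.2⟩) hL
        _ = L * M * J := by ring
  rw [sub_zero, abs_of_nonneg ha] at this
  linarith

/-- From `(xG)' = f(x) G`, the product `xG e^{r₁s}` increases and `xG e^{r₂s}` decreases after time
`a`. The factor `x` is then removed by `x a ≤ x (a + t) ≤ 1`. -/
theorem survival_bounds (hfh : IsResettingPair f h) (hε : 0 < ε) (hx : IsFlow f h ε x)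
    {a : ℝ} (ha : 0 ≤ a) {r₁ r₂ : ℝ} (hy : 0 < x a)
    (h₁ : ∀ u ∈ Set.Icc (x a) 1, -r₁ * u ≤ f u) (h₂ : ∀ u ∈ Set.Icc (x a) 1, f u ≤ -r₂ * u)
    {t : ℝ} (ht : 0 ≤ t) :
    x a * Real.exp (-r₁ * t) ≤ survival h ε x (a + t) / survival h ε x a ∧
      survival h ε x (a + t) / survival h ε x a ≤ Real.exp (-r₂ * t) := by
  have hmono := (hx.strictMonoOn hfh hε).monotoneOn
  have hxmem : ∀ s, a ≤ s → x s ∈ Set.Icc (x a) 1 := fun s hs =>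
    ⟨hmono ha (ha.trans hs) hs, (hx.mem_Icc s (ha.trans hs)).2⟩
  have hd : ∀ (r s : ℝ), a < s → HasDerivAt
      (fun s => x s * survival h ε x s * Real.exp (r * s))
      ((f (x s) + r * x s) * (survival h ε x s * Real.exp (r * s))) s := fun r s hs => by
    have h0 : 0 < s := ha.trans_lt hs
    have d1 := (hx.hasDerivWithinAt_mul_survival hfh hε h0.le).hasDerivAt (Ici_mem_nhds h0)
    have d2 : HasDerivAt (fun s => Real.exp (r * s)) (Real.exp (r * s) * (r * 1)) s :=
      ((hasDerivAt_id s).const_mul r).exp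
    refine (d1.mul d2).congr_deriv ?_
    ring
  have hc : ∀ r : ℝ, ContinuousOn (fun s => x s * survival h ε x s * Real.exp (r * s))
      (Set.Ici a) := fun r =>
    ((hx.continuousOn.mul (hx.continuousOn_survival hfh)).mono fun s hs => ha.trans hs).mul
      (by fun_prop)
  have hdiff : ∀ r : ℝ, DifferentiableOn ℝ (fun s => x s * survival h ε x s * Real.exp (r * s))
      (interior (Set.Ici a)) := fun r s hs => by
    rw [interior_Ici] at hs
    exact (hd r s hs).differentiableAt.differentiableWithinAt
  have m1 : MonotoneOn (fun s => x s * survival h ε x s * Real.exp (r₁ * s)) (Set.Ici a) := by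
    refine monotoneOn_of_deriv_nonneg (convex_Ici a) (hc r₁) (hdiff r₁) fun s hs => ?_
    rw [interior_Ici] at hs
    rw [(hd r₁ s hs).deriv]
    have := h₁ _ (hxmem s (le_of_lt hs))
    exact mul_nonneg (by linarith) (mul_nonneg (survival_pos ..).le (Real.exp_pos _).le)
  have m2 : AntitoneOn (fun s => x s * survival h ε x s * Real.exp (r₂ * s)) (Set.Ici a) := by
    refine antitoneOn_of_deriv_nonpos (convex_Ici a) (hc r₂) (hdiff r₂) fun s hs => ?_
    rw [interior_Ici] at hs
    rw [(hd r₂ s hs).deriv]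
    have := h₂ _ (hxmem s (le_of_lt hs))
    exact mul_nonpos_of_nonpos_of_nonneg (by linarith)
      (mul_nonneg (survival_pos ..).le (Real.exp_pos _).le)
  have hat : a + t ∈ Set.Ici a := by simpa using ht
  have i1 := m1 Set.self_mem_Ici hat hat
  have i2 := m2 Set.self_mem_Ici hat hat
  have hGa := survival_pos h ε x a
  have hGt := survival_pos h ε x (a + t)
  obtain ⟨hx1, hx2⟩ := hxmem (a + t) hat
  simp only [mul_add, Real.exp_add] at i1 i2
  rw [le_div_iff₀ hGa, div_le_iff₀ hGa]
  constructor
  · have e1 := Real.exp_pos (r₁ * a)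
    have e2 := Real.exp_pos (r₁ * t)
    have : x a * survival h ε x a ≤ x (a + t) * survival h ε x (a + t) * Real.exp (r₁ * t) := by
      refine le_of_mul_le_mul_right ?_ e1
      linarith
    rw [neg_mul, Real.exp_neg]
    have h3 : x (a + t) * survival h ε x (a + t) * Real.exp (r₁ * t) ≤
        1 * survival h ε x (a + t) * Real.exp (r₁ * t) := by gcongr
    rw [mul_right_comm, ← div_eq_mul_inv, div_le_iff₀ e2]
    linarith
  · have e1 := Real.exp_pos (r₂ * a)
    have e2 := Real.exp_pos (r₂ * t)
    have h2 : x (a + t) * survival h ε x (a + t) * Real.exp (r₂ * t) ≤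
        x a * survival h ε x a := by
      refine le_of_mul_le_mul_right ?_ e1
      linarith
    have h3 : x a * survival h ε x (a + t) * Real.exp (r₂ * t) ≤
        x (a + t) * survival h ε x (a + t) * Real.exp (r₂ * t) := by gcongr
    rw [neg_mul, Real.exp_neg, inv_mul_eq_div, le_div_iff₀ e2]
    refine le_of_mul_le_mul_left ?_ hy
    linarith

end IsFlow

/-! ### Limits of the characteristic functions of the sojourns -/

/-- The characteristic function of the exponential law of parameter `r`. -/
noncomputable def expChar (r ξ : ℝ) : ℂ := 1 / (1 - (ξ : ℂ) * Complex.I * (1 / (r : ℂ)))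

theorem one_sub_mul_I_ne_zero (ξ r : ℝ) : 1 - (ξ : ℂ) * Complex.I * (1 / (r : ℂ)) ≠ 0 := by
  intro h
  have := congrArg Complex.re h
  have e : (ξ : ℂ) * Complex.I * (1 / (r : ℂ)) = ((ξ / r : ℝ) : ℂ) * Complex.I := by
    push_cast
    ring
  rw [e] at this
  simp at this

/-- The integral is `1 / (r - iξ)`. The left side is the form in which the sojourn above the level
arrives in the limit. -/
theorem one_add_integral_exp_mul_exp {r : ℝ} (hr : 0 < r) (ξ : ℝ) :
    1 + (ξ : ℂ) * Complex.I * ∫ t in Set.Ioi (0 : ℝ),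
      Complex.exp (((ξ * t : ℝ) : ℂ) * Complex.I) * (Real.exp (-r * t) : ℝ) = expChar r ξ := by
  have hre : (-(r : ℂ) + ξ * Complex.I).re < 0 := by simpa using hr
  have hne : -(r : ℂ) + ξ * Complex.I ≠ 0 := fun h => by
    rw [h] at hre
    simp at hre
  have h1 : ∀ t : ℝ, Complex.exp (((ξ * t : ℝ) : ℂ) * Complex.I) * (Real.exp (-r * t) : ℝ) =
      Complex.exp ((-(r : ℂ) + ξ * Complex.I) * t) := fun t => by
    rw [Complex.ofReal_exp, ← Complex.exp_add]
    push_cast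
    ring_nf
  simp only [h1]
  rw [integral_exp_mul_complex_Ioi hre, expChar, eq_div_iff (one_sub_mul_I_ne_zero ξ r)]
  have hr' : (r : ℂ) ≠ 0 := by exact_mod_cast hr.ne'
  simp only [Complex.ofReal_zero, mul_zero, Complex.exp_zero]
  field_simp
  ring

theorem expMeasure_real_Ioi {r : ℝ} (hr : 0 < r) {t : ℝ} (ht : 0 ≤ t) :
    (expMeasure r).real (Set.Ioi t) = Real.exp (-r * t) := by
  have := isProbabilityMeasure_expMeasure hr
  rw [← Set.compl_Iic, probReal_compl_eq_one_sub measurableSet_Iic, ← cdf_eq_real,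
    cdf_expMeasure_eq hr, if_pos ht]
  simp

theorem ae_expMeasure_pos {r : ℝ} (hr : 0 < r) : ∀ᵐ u ∂(expMeasure r), 0 < u := by
  have := isProbabilityMeasure_expMeasure hr
  have h0 := expMeasure_real_Ioi hr (le_refl 0)
  rw [mul_zero, Real.exp_zero, measureReal_def, ENNReal.toReal_eq_one_iff] at h0
  exact (prob_compl_eq_zero_iff measurableSet_Ioi).2 h0

theorem charFun_expMeasure {r : ℝ} (hr : 0 < r) (ξ : ℝ) :
    charFun (expMeasure r) ξ = expChar r ξ := by
  have := isProbabilityMeasure_expMeasure hr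
  have hset : ∀ t, {u : ℝ | t < u} = Set.Ioi t := fun t => rfl
  have htail : Set.EqOn (fun t => Real.exp (-r * t)) (fun t => (expMeasure r).real (Set.Ioi t))
      (Set.Ioi 0) := fun t ht => (expMeasure_real_Ioi hr (le_of_lt ht)).symm
  have hint : IntegrableOn (fun t => (expMeasure r).real (Set.Ioi t)) (Set.Ioi 0) :=
    (exp_neg_integrableOn_Ioi 0 hr).congr_fun htail measurableSet_Ioi
  have := integral_exp_eq_add_setIntegral_tail (μ := expMeasure r) (Y := fun u => u)
    measurable_id ((ae_expMeasure_pos hr).mono fun u hu => hu.le) hint ξ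
  rw [charFun_apply_real, ← one_add_integral_exp_mul_exp hr ξ]
  simp only [hset, probReal_univ, Complex.ofReal_one] at this
  push_cast at this ⊢
  rw [this]
  congr 2
  refine setIntegral_congr_fun measurableSet_Ioi fun t ht => ?_
  have h2 := htail ht
  simp only at h2 ⊢
  rw [← h2]
  push_cast
  rfl

/-! ### Truncated characteristic functions of a gap and the solved recursion -/

section Gaps

variable (ν : Measure ℝ) [IsProbabilityMeasure ν] (a ξ : ℝ)

theorem measurable_real_Ioi : Measurable fun t => ν.real (Set.Ioi t) :=
  Antitone.measurable fun _ _ hst => measureReal_mono (Set.Ioi_subset_Ioi hst)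

/-- The layer-cake formula for `min u a`, whose tail is that of `u` cut off at `a`; the values of
`u` above `a` contribute the term `e^{iξa} ν(a, ∞)`. -/
theorem integral_Iic_exp_eq {a : ℝ} (ha : 0 < a) (hν : ∀ᵐ u ∂ν, 0 < u) :
    1 - ∫ u in Set.Iic a, Complex.exp (((ξ * u : ℝ) : ℂ) * Complex.I) ∂ν =
      Complex.exp (((ξ * a : ℝ) : ℂ) * Complex.I) * ν.real (Set.Ioi a) -
      (ξ : ℂ) * Complex.I * ∫ t in (0 : ℝ)..a,
        Complex.exp (((ξ * t : ℝ) : ℂ) * Complex.I) * ν.real (Set.Ioi t) := by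
  have hset : ∀ t, {u : ℝ | t < min u a} = if t < a then Set.Ioi t else ∅ := fun t => by
    ext u
    split_ifs with h <;> simp [h]
  have htail : (fun t => ν.real {u : ℝ | t < min u a}) =
      (Set.Iio a).indicator fun t => ν.real (Set.Ioi t) := by
    ext t
    rw [hset]
    by_cases h : t < a <;> simp [h, Set.indicator]
  have hind : ∀ g : ℝ → ℂ, ∫ t in Set.Ioi (0 : ℝ), (Set.Iio a).indicator g t =
      ∫ t in (0 : ℝ)..a, g t := fun g => by
    rw [intervalIntegral.integral_of_le ha.le, integral_indicator measurableSet_Iio,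
      Measure.restrict_restrict measurableSet_Iio, integral_Ioc_eq_integral_Ioo]
    congr 2
    ext t
    simp [and_comm]
  have hint : IntegrableOn (fun t => ν.real {u : ℝ | t < min u a}) (Set.Ioi 0) := by
    rw [htail, IntegrableOn, integrable_indicator_iff measurableSet_Iio, IntegrableOn,
      Measure.restrict_restrict measurableSet_Iio]
    have : IsFiniteMeasure ((volume : Measure ℝ).restrict (Set.Iio a ∩ Set.Ioi 0)) :=
      ⟨by rw [Measure.restrict_apply_univ, Set.inter_comm, Set.Ioi_inter_Iio]; simp⟩
    refine Integrable.of_bound (C := 1) (measurable_real_Ioi ν).aestronglyMeasurable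
      (Eventually.of_forall fun t => ?_)
    rw [Real.norm_eq_abs, abs_of_nonneg measureReal_nonneg]
    exact measureReal_le_one
  have key := integral_exp_eq_add_setIntegral_tail (μ := ν) (Y := fun u => min u a)
    (by fun_prop) (hν.mono fun u hu => le_min hu.le ha.le) hint ξ
  have hsplit : ∫ u, Complex.exp (((ξ * min u a : ℝ) : ℂ) * Complex.I) ∂ν =
      (∫ u in Set.Iic a, Complex.exp (((ξ * u : ℝ) : ℂ) * Complex.I) ∂ν) +
        Complex.exp (((ξ * a : ℝ) : ℂ) * Complex.I) * ν.real (Set.Ioi a) := by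
    rw [← integral_add_compl measurableSet_Iic (integrable_exp_ofReal_mul_I (by fun_prop)),
      Set.compl_Iic]
    congr 1
    · refine setIntegral_congr_fun measurableSet_Iic fun u hu => ?_
      simp only [min_eq_left (Set.mem_Iic.1 hu)]
    · rw [setIntegral_congr_fun (g := fun _ => Complex.exp (((ξ * a : ℝ) : ℂ) * Complex.I))
        measurableSet_Ioi fun u hu => by simp only [min_eq_right (le_of_lt (Set.mem_Ioi.1 hu))],
        setIntegral_const, Complex.real_smul, mul_comm]
  have htail' : ∀ t, Complex.exp (((ξ * t : ℝ) : ℂ) * Complex.I) * ν.real {u : ℝ | t < min u a} =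
      (Set.Iio a).indicator (fun t => Complex.exp (((ξ * t : ℝ) : ℂ) * Complex.I) *
        ν.real (Set.Ioi t)) t := fun t => by
    rw [congrFun htail t]
    by_cases h : t < a <;> simp [h, Set.indicator]
  rw [hsplit] at key
  simp only [htail', hind, probReal_univ, Complex.ofReal_one] at key
  linear_combination -key

theorem integral_Ioi_exp_eq (hint : IntegrableOn (fun t => ν.real (Set.Ioi (a + t))) (Set.Ioi 0)) :
    ∫ u in Set.Ioi a, Complex.exp (((ξ * (u - a) : ℝ) : ℂ) * Complex.I) ∂ν =
      ν.real (Set.Ioi a) + (ξ : ℂ) * Complex.I * ∫ t in Set.Ioi (0 : ℝ),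
        Complex.exp (((ξ * t : ℝ) : ℂ) * Complex.I) * ν.real (Set.Ioi (a + t)) := by
  have hset : ∀ t ∈ Set.Ioi (0 : ℝ), ν.real (Set.Ioi (a + t)) =
      (ν.restrict (Set.Ioi a)).real {u : ℝ | t < u - a} := fun t ht => by
    rw [measureReal_restrict_apply (measurableSet_lt measurable_const (by fun_prop))]
    congr 1
    ext u
    simp only [Set.mem_Ioi, Set.mem_inter_iff, Set.mem_ofPred_eq] at ht ⊢
    constructor
    · intro h
      constructor <;> linarith
    · intro h
      linarith [h.1]
  have key := integral_exp_eq_add_setIntegral_tail (μ := ν.restrict (Set.Ioi a))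
    (Y := fun u => u - a) (by fun_prop)
    ((ae_restrict_mem measurableSet_Ioi).mono fun u hu => sub_nonneg.2 (le_of_lt hu))
    (hint.congr_fun hset measurableSet_Ioi) ξ
  rw [key, measureReal_restrict_apply_univ]
  congr 2
  refine setIntegral_congr_fun measurableSet_Ioi fun t ht => ?_
  simp only [hset t ht]

/-- Solve the linear recursion, then divide numerator and denominator by `e^{iξ₀a} ν(a, ∞)`. Only
ratios of tails remain; these have limits, whereas `ν(a, ∞)` itself may vanish in the limit. -/
theorem sojournChar_succ_eq_mul {a : ℝ} (ha : 0 < a) (hν : ∀ᵐ u ∂ν, 0 < u)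
    (hp : 0 < ν.real (Set.Ioi a))
    (hint : IntegrableOn (fun t => ν.real (Set.Ioi (a + t))) (Set.Ioi 0)) (k : ℕ) (ξ : ℕ → ℝ) :
    sojournChar ν a (k + 1) ξ =
      1 / (1 - (ξ 0 : ℂ) * Complex.I * ∫ t in (0 : ℝ)..a,
        Complex.exp (((ξ 0 * (t - a) : ℝ) : ℂ) * Complex.I) *
          ((ν.real (Set.Ioi t) / ν.real (Set.Ioi a) : ℝ) : ℂ)) *
      (1 + (ξ 1 : ℂ) * Complex.I * ∫ t in Set.Ioi (0 : ℝ),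
        Complex.exp (((ξ 1 * t : ℝ) : ℂ) * Complex.I) *
          ((ν.real (Set.Ioi (a + t)) / ν.real (Set.Ioi a) : ℝ) : ℂ)) *
      sojournChar ν a k fun j => ξ (j + 2) := by
  set p := ν.real (Set.Ioi a) with hpdef
  have hpc : (p : ℂ) ≠ 0 := by exact_mod_cast hp.ne'
  have hp0 : ν (Set.Ioi a) ≠ 0 := fun h => by
    rw [hpdef, measureReal_def, h] at hp
    simp at hp
  set e := Complex.exp (((ξ 0 * a : ℝ) : ℂ) * Complex.I) with he
  have hene : e ≠ 0 := Complex.exp_ne_zero _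
  have h1 : ∫ t in (0 : ℝ)..a, Complex.exp (((ξ 0 * (t - a) : ℝ) : ℂ) * Complex.I) *
      ((ν.real (Set.Ioi t) / p : ℝ) : ℂ) = e⁻¹ * (p : ℂ)⁻¹ *
      ∫ t in (0 : ℝ)..a, Complex.exp (((ξ 0 * t : ℝ) : ℂ) * Complex.I) * ν.real (Set.Ioi t) := by
    rw [← intervalIntegral.integral_const_mul]
    congr 1
    ext t
    rw [mul_sub, Complex.ofReal_sub, sub_mul, Complex.exp_sub, ← he]
    push_cast
    field_simp
  have h2 : ∫ t in Set.Ioi (0 : ℝ), Complex.exp (((ξ 1 * t : ℝ) : ℂ) * Complex.I) *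
      ((ν.real (Set.Ioi (a + t)) / p : ℝ) : ℂ) = (p : ℂ)⁻¹ *
      ∫ t in Set.Ioi (0 : ℝ), Complex.exp (((ξ 1 * t : ℝ) : ℂ) * Complex.I) *
        ν.real (Set.Ioi (a + t)) := by
    rw [← integral_const_mul]
    congr 1
    ext t
    push_cast
    field_simp
  -- The integral has modulus at most `ν(-∞, a] = 1 - p < 1`.
  have hα : 1 - ∫ u in Set.Iic a, Complex.exp (((ξ 0 * u : ℝ) : ℂ) * Complex.I) ∂ν ≠ 0 := by
    intro h0
    have hle : ‖∫ u in Set.Iic a, Complex.exp (((ξ 0 * u : ℝ) : ℂ) * Complex.I) ∂ν‖ ≤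
        1 * ν.real (Set.Iic a) :=
      norm_setIntegral_le_of_norm_le_const (measure_lt_top _ _) fun u _ => by
        rw [Complex.norm_exp_ofReal_mul_I]
    rw [← sub_eq_zero.1 h0, norm_one, one_mul] at hle
    have : p = 1 - ν.real (Set.Iic a) := by
      rw [hpdef, ← Set.compl_Iic, probReal_compl_eq_one_sub measurableSet_Iic]
    linarith
  have hrec := sojournChar_succ_eq_add ν hp0 k ξ
  rw [integral_Ioi_exp_eq ν a (ξ 1) hint, ← hpdef, ← he] at hrec
  have hαe := integral_Iic_exp_eq ν (ξ 0) ha hν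
  rw [← hpdef, ← he] at hαe
  rw [h1, h2]
  set α := ∫ u in Set.Iic a, Complex.exp (((ξ 0 * u : ℝ) : ℂ) * Complex.I) ∂ν with hαdef
  set I₀ := ∫ t in (0 : ℝ)..a, Complex.exp (((ξ 0 * t : ℝ) : ℂ) * Complex.I) *
    ν.real (Set.Ioi t) with hI₀
  have hden : 1 - (ξ 0 : ℂ) * Complex.I * (e⁻¹ * (p : ℂ)⁻¹ * I₀) = e⁻¹ * (p : ℂ)⁻¹ * (1 - α) := by
    rw [hαe]
    field_simp
  rw [hden]
  have hS : sojournChar ν a (k + 1) ξ * (1 - α) = e * (p + ξ 1 * Complex.I *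
      ∫ t in Set.Ioi (0 : ℝ), Complex.exp (((ξ 1 * t : ℝ) : ℂ) * Complex.I) *
        ν.real (Set.Ioi (a + t))) * sojournChar ν a k fun j => ξ (j + 2) := by
    linear_combination hrec
  rw [eq_div_iff hα |>.2 hS]
  field_simp

end Gaps

/-- Convergence of the joint characteristic functions of the sojourns to those of independent
exponential variables. -/
theorem tendsto_sojournChar {ι : Type*} {l : Filter ι} [l.IsCountablyGenerated]
    {ν : ι → Measure ℝ} [∀ i, IsProbabilityMeasure (ν i)] {a : ι → ℝ} {r₀ r₁ c : ℝ} (hr₁ : 0 < r₁)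
    (hc : 0 < c) (hν : ∀ i, ∀ᵐ u ∂(ν i), 0 < u) (ha : ∀ᶠ i in l, 0 < a i) (ha0 : Tendsto a l (𝓝 0))
    (hp : ∀ᶠ i in l, 0 < (ν i).real (Set.Ioi (a i)))
    (hJ : Tendsto (fun i => ∫ t in (0 : ℝ)..a i,
      (ν i).real (Set.Ioi t) / (ν i).real (Set.Ioi (a i))) l (𝓝 (1 / r₀)))
    (hT : ∀ t, 0 < t → Tendsto (fun i =>
      (ν i).real (Set.Ioi (a i + t)) / (ν i).real (Set.Ioi (a i))) l (𝓝 (Real.exp (-r₁ * t))))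
    (hdom : ∀ᶠ i in l, ∀ t, 0 < t →
      (ν i).real (Set.Ioi (a i + t)) / (ν i).real (Set.Ioi (a i)) ≤ Real.exp (-c * t))
    (k : ℕ) (ξ : ℕ → ℝ) :
    Tendsto (fun i => sojournChar (ν i) (a i) k ξ) l
      (𝓝 (∏ j ∈ Finset.range (2 * k), expChar (if Even j then r₀ else r₁) (ξ j))) := by
  induction k generalizing ξ with
  | zero => simpa [sojournChar] using tendsto_const_nhds
  | succ k ih =>
    -- On `[0, a]` the oscillating factor is within `|ξ₀| a` of `1`, so it disappears as `a → 0` and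
    -- `hJ` remains.
    have hA : Tendsto (fun i => ∫ t in (0 : ℝ)..a i,
        Complex.exp (((ξ 0 * (t - a i) : ℝ) : ℂ) * Complex.I) *
          (((ν i).real (Set.Ioi t) / (ν i).real (Set.Ioi (a i)) : ℝ) : ℂ)) l
        (𝓝 (1 / (r₀ : ℂ))) := by
      have hJc : Tendsto (fun i => ((∫ t in (0 : ℝ)..a i,
          (ν i).real (Set.Ioi t) / (ν i).real (Set.Ioi (a i)) : ℝ) : ℂ)) l (𝓝 (1 / (r₀ : ℂ))) := by
        have e : ((1 / r₀ : ℝ) : ℂ) = 1 / (r₀ : ℂ) := by push_cast; rfl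
        rw [← e]
        exact (Complex.continuous_ofReal.tendsto _).comp hJ
      have hbound : Tendsto (fun i => |ξ 0| * a i * ∫ t in (0 : ℝ)..a i,
          (ν i).real (Set.Ioi t) / (ν i).real (Set.Ioi (a i))) l (𝓝 0) := by
        have := (ha0.const_mul |ξ 0|).mul hJ
        simpa using this
      refine (tendsto_iff_of_dist (squeeze_zero' (Eventually.of_forall fun _ => dist_nonneg) ?_
        hbound)).1 hJc
      filter_upwards [ha] with i hi
      have hanti : AntitoneOn (fun t => (ν i).real (Set.Ioi t) / (ν i).real (Set.Ioi (a i)))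
          (Set.uIcc 0 (a i)) := fun s _ t _ hst =>
        div_le_div_of_nonneg_right (measureReal_mono (Set.Ioi_subset_Ioi hst)) measureReal_nonneg
      have hii := hanti.intervalIntegrable (μ := volume)
      have hiic : IntervalIntegrable (fun t =>
          (((ν i).real (Set.Ioi t) / (ν i).real (Set.Ioi (a i)) : ℝ) : ℂ)) volume 0 (a i) :=
        ⟨hii.1.ofReal, hii.2.ofReal⟩
      have hii' : IntervalIntegrable (fun t =>
          Complex.exp (((ξ 0 * (t - a i) : ℝ) : ℂ) * Complex.I) *
          (((ν i).real (Set.Ioi t) / (ν i).real (Set.Ioi (a i)) : ℝ) : ℂ)) volume 0 (a i) :=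
        hiic.continuousOn_mul (by fun_prop)
      rw [dist_comm, dist_eq_norm, ← intervalIntegral.integral_ofReal,
        ← intervalIntegral.integral_sub hii' hiic, ← intervalIntegral.integral_const_mul]
      refine intervalIntegral.norm_integral_le_of_norm_le hi.le ?_ (hii.const_mul _)
      refine Eventually.of_forall fun t ht => ?_
      have hq : 0 ≤ (ν i).real (Set.Ioi t) / (ν i).real (Set.Ioi (a i)) := by positivity
      rw [← sub_one_mul, norm_mul, Complex.norm_real, Real.norm_eq_abs, abs_of_nonneg hq]
      gcongr
      rw [mul_comm]
      refine Real.norm_exp_I_mul_ofReal_sub_one_le.trans ?_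
      rw [Real.norm_eq_abs, abs_mul]
      gcongr
      rw [abs_le]
      constructor <;> linarith [ht.1, ht.2]
    have hB : Tendsto (fun i => ∫ t in Set.Ioi (0 : ℝ),
        Complex.exp (((ξ 1 * t : ℝ) : ℂ) * Complex.I) *
          (((ν i).real (Set.Ioi (a i + t)) / (ν i).real (Set.Ioi (a i)) : ℝ) : ℂ)) l
        (𝓝 (∫ t in Set.Ioi (0 : ℝ),
          Complex.exp (((ξ 1 * t : ℝ) : ℂ) * Complex.I) * (Real.exp (-r₁ * t) : ℝ))) := by
      refine tendsto_integral_filter_of_dominated_convergence (fun t => Real.exp (-c * t)) ?_ ?_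
        (exp_neg_integrableOn_Ioi 0 hc) ?_
      · refine Eventually.of_forall fun i => Measurable.aestronglyMeasurable ?_
        have := (measurable_real_Ioi (ν i)).comp (measurable_const_add (a i))
        have h2 := this.div_const ((ν i).real (Set.Ioi (a i)))
        exact (by fun_prop : Measurable fun t : ℝ =>
          Complex.exp (((ξ 1 * t : ℝ) : ℂ) * Complex.I)).mul h2.complex_ofReal
      · filter_upwards [hdom] with i hi
        filter_upwards [ae_restrict_mem measurableSet_Ioi] with t ht
        rw [norm_mul, Complex.norm_exp_ofReal_mul_I, one_mul, Complex.norm_real, Real.norm_eq_abs,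
          abs_of_nonneg (by positivity)]
        exact hi t ht
      · filter_upwards [ae_restrict_mem measurableSet_Ioi] with t ht
        exact ((Complex.continuous_ofReal.tendsto _).comp (hT t ht)).const_mul _
    have hlim := (((tendsto_const_nhds (x := (1 : ℂ))).div ((tendsto_const_nhds (x := (1 : ℂ))).sub
      (hA.const_mul ((ξ 0 : ℂ) * Complex.I))) (one_sub_mul_I_ne_zero (ξ 0) r₀)).mul
      ((hB.const_mul ((ξ 1 : ℂ) * Complex.I)).const_add 1)).mul (ih fun j => ξ (j + 2))
    rw [one_add_integral_exp_mul_exp hr₁] at hlim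
    have hprod : ∏ j ∈ Finset.range (2 * (k + 1)), expChar (if Even j then r₀ else r₁) (ξ j) =
        expChar r₀ (ξ 0) * expChar r₁ (ξ 1) *
          ∏ j ∈ Finset.range (2 * k), expChar (if Even j then r₀ else r₁) (ξ (j + 2)) := by
      rw [show 2 * (k + 1) = 2 * k + 1 + 1 by ring, Finset.prod_range_succ',
        Finset.prod_range_succ']
      have heven : ∀ j : ℕ, Even (j + 1 + 1) ↔ Even j := fun j => by
        simp [Nat.even_add_one]
      simp only [heven]
      simp
      ring
    rw [hprod]
    refine hlim.congr' ?_
    filter_upwards [ha, hp, hdom] with i hai hpi hdi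
    refine (sojournChar_succ_eq_mul (ν i) hai (hν i) hpi ?_ k ξ).symm
    have hdiv : IntegrableOn (fun t => (ν i).real (Set.Ioi (a i + t)) /
        (ν i).real (Set.Ioi (a i))) (Set.Ioi 0) := by
      refine (exp_neg_integrableOn_Ioi 0 hc).mono' ?_ ?_
      · exact (((measurable_real_Ioi (ν i)).comp (measurable_const_add (a i))).div_const
          _).aestronglyMeasurable
      · filter_upwards [ae_restrict_mem measurableSet_Ioi] with t ht
        rw [Real.norm_eq_abs, abs_of_nonneg (by positivity)]
        exact hdi t ht
    have hmul : IntegrableOn (fun t => (ν i).real (Set.Ioi (a i + t)) /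
        (ν i).real (Set.Ioi (a i)) * (ν i).real (Set.Ioi (a i))) (Set.Ioi 0) := hdiv.mul_const _
    exact hmul.congr_fun (fun t _ => div_mul_cancel₀ _ hpi.ne') measurableSet_Ioi

/-! ### The law of the gaps -/

namespace IsResetGaps

variable {h : ℝ → ℝ} {ε : ℝ} {x : ℝ → ℝ} {Ω : Type*} [MeasurableSpace Ω] {P : Measure Ω} {σ : ℕ → Ω → ℝ}

theorem map_apply_Ioi [IsProbabilityMeasure P] (hσ : IsResetGaps h ε x P σ) (n : ℕ) {t : ℝ} (ht : 0 ≤ t) :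
    P.map (σ n) (Set.Ioi t) = ENNReal.ofReal (survival h ε x t) := by
  rw [Measure.map_apply (hσ.measurable n) measurableSet_Ioi]
  rcases eq_or_lt_of_le ht with rfl | ht
  · have : σ n ⁻¹' Set.Ioi 0 = Set.univ := Set.eq_univ_of_forall fun ω => hσ.pos n ω
    rw [this, survival_zero, measure_univ, ENNReal.ofReal_one]
  · exact hσ.tail n t ht

theorem map_real_Ioi [IsProbabilityMeasure P] (hσ : IsResetGaps h ε x P σ) (n : ℕ) {t : ℝ} (ht : 0 ≤ t) :
    (P.map (σ n)).real (Set.Ioi t) = survival h ε x t := by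
  rw [measureReal_def, hσ.map_apply_Ioi n ht, ENNReal.toReal_ofReal (survival_pos ..).le]

/-- The tail formula for `t > 0` together with positivity determines the law, so the gaps are
identically distributed. -/
theorem map_eq_map_zero [IsProbabilityMeasure P] (hσ : IsResetGaps h ε x P σ) (n : ℕ) : P.map (σ n) = P.map (σ 0) := by
  have := fun n => Measure.isProbabilityMeasure_map (μ := P) (hσ.measurable n).aemeasurable
  refine Measure.ext_of_Iic _ _ fun t => ?_
  rw [← Set.compl_Ioi, measure_compl measurableSet_Ioi (measure_ne_top _ _),
    measure_compl measurableSet_Ioi (measure_ne_top _ _), measure_univ, measure_univ]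
  congr 1
  rcases le_or_gt 0 t with ht | ht
  · rw [hσ.map_apply_Ioi n ht, hσ.map_apply_Ioi 0 ht]
  · have : ∀ n, P.map (σ n) (Set.Ioi t) = 1 := fun n => by
      rw [Measure.map_apply (hσ.measurable n) measurableSet_Ioi,
        Set.eq_univ_of_forall (s := σ n ⁻¹' Set.Ioi t) fun ω => ht.trans (hσ.pos n ω), measure_univ]
    rw [this, this]

theorem ae_map_pos (hσ : IsResetGaps h ε x P σ) : ∀ᵐ u ∂(P.map (σ 0)), 0 < u :=
  (ae_map_iff (hσ.measurable 0).aemeasurable measurableSet_Ioi).2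
    (Eventually.of_forall fun ω => hσ.pos 0 ω)

theorem map_seq_eq [IsProbabilityMeasure P] (hσ : IsResetGaps h ε x P σ) :
    P.map (fun ω n => σ n ω) = Measure.infinitePi fun _ : ℕ => P.map (σ 0) := by
  rw [hσ.indep.map_fun_eq_infinitePi_map hσ.measurable]
  simp only [hσ.map_eq_map_zero]

theorem ae_frequently [IsProbabilityMeasure P] (hσ : IsResetGaps h ε x P σ) {a : ℝ} (ha : 0 < a) :
    ∀ᵐ ω ∂P, ∃ᶠ n in atTop, a < σ n ω :=
  ae_frequently_lt hσ.measurable hσ.indep (p := ENNReal.ofReal (survival h ε x a))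
    (by simpa using survival_pos h ε x a) fun n => (hσ.tail n a ha).ge

theorem measurable_sojourn_seq (hσ : IsResetGaps h ε x P σ) (a : ℝ) :
    Measurable fun ω n => sojourn a n fun m => σ m ω :=
  measurable_pi_lambda _ fun n => (measurable_sojourn a n).comp
    (measurable_pi_lambda _ hσ.measurable)

/-- The frequency vector is extended by `0` past `2 * k`, which is harmless: `sojournChar` reads
only the first `2 * k` frequencies. -/
theorem charFun_sojourn [IsProbabilityMeasure P] (hσ : IsResetGaps h ε x P σ)
    [IsProbabilityMeasure (P.map (σ 0))] (a : ℝ) (k : ℕ)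
    (t : EuclideanSpace ℝ (Fin (2 * k))) :
    charFun (P.map fun ω => WithLp.toLp 2 fun j : Fin (2 * k) => sojourn a j fun n => σ n ω) t =
      sojournChar (P.map (σ 0)) a k fun j => if hj : j < 2 * k then t ⟨j, hj⟩ else 0 := by
  have hm : Measurable fun ω => WithLp.toLp 2 fun j : Fin (2 * k) => sojourn a j fun n => σ n ω := by
    have h1 : Measurable fun ω => fun j : Fin (2 * k) => sojourn a j fun n => σ n ω :=
      measurable_pi_lambda _ fun j => (measurable_pi_apply (j : ℕ)).comp (hσ.measurable_sojourn_seq a)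
    exact (by fun_prop : Measurable fun v : Fin (2 * k) → ℝ => WithLp.toLp 2 v).comp h1
  have hs := measurable_sojourn a
  have hE : Measurable fun s : ℕ → ℝ => Complex.exp (((∑ j ∈ Finset.range (2 * k),
      (if hj : j < 2 * k then t ⟨j, hj⟩ else 0) * sojourn a j s : ℝ) : ℂ) * Complex.I) := by fun_prop
  rw [charFun_apply, integral_map hm.aemeasurable (by fun_prop), sojournChar, ← hσ.map_seq_eq,
    integral_map (measurable_pi_lambda _ hσ.measurable).aemeasurable hE.aestronglyMeasurable]
  congr 1
  ext ω
  congr 3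
  rw [PiLp.inner_apply, Finset.sum_range]
  refine Finset.sum_congr rfl fun j _ => ?_
  simp

end IsResetGaps

/-! ### The switching path of the resetting process -/

section Hitting

variable {f h : ℝ → ℝ} {ε y : ℝ} {x : ℝ → ℝ}

/-- `a` is the positive time at which `x` crosses the level `y`. -/
def IsCrossing (x : ℝ → ℝ) (y a : ℝ) : Prop :=
  0 < a ∧ ∀ t, 0 ≤ t → (y < x t ↔ a < t)

/-- For `ε ≥ 1` the level `1 - ε ^ β` is not positive. The path then exceeds it at arbitrarily small
times, so all switching times collapse to `0`. -/
theorem switchPath_eq_zero_of_nonpos (hfh : IsResettingPair f h) (hε : 0 < ε)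
    (hx : IsFlow f h ε x) (hy : y ≤ 0) {s : ℕ → ℝ} (hs : ∀ n, 0 < s n) :
    switchPath (resettingPath x s) y = fun _ => 0 := by
  have hval : ∀ t : ℝ≥0, (t : ℝ) < s 0 → resettingPath x s t = x t := fun t ht => by
    rw [resettingPath_eq x hs (n := 0) (by rw [partialTime_zero]; exact t.2)
      (by rw [partialTime_succ, partialTime_zero, zero_add]; exact ht), partialTime_zero, sub_zero]
  refine switchPath_eq_zero_of_frequently ?_ fun δ hδ => ?_
  · rw [hval 0 (by simpa using hs 0), NNReal.coe_zero, hx.init]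
  · obtain ⟨t, ht0, ht⟩ : ∃ t : ℝ≥0, 0 < t ∧ t < min δ (s 0).toNNReal :=
      exists_between (lt_min hδ (Real.toNNReal_pos.2 (hs 0)))
    have ht2 : (t : ℝ) < s 0 := Real.lt_toNNReal_iff_coe_lt.1 (ht.trans_le (min_le_right _ _))
    refine ⟨t, ht.trans_le (min_le_left _ _), ?_⟩
    rw [hval t ht2]
    refine hy.trans_lt ?_
    have := hx.strictMonoOn hfh hε Set.self_mem_Ici (Set.mem_Ici.2 t.2)
      (show (0 : ℝ) < t by exact_mod_cast ht0)
    rwa [hx.init] at this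

/-- If a positive level has no crossing time, the flow never exceeds it. This settles the values of
`ε` to which the asymptotics do not apply. -/
theorem switchPath_eq_zero_of_not_crossing (hfh : IsResettingPair f h) (hε : 0 < ε)
    (hx : IsFlow f h ε x) (hcr : ¬ ∃ a, IsCrossing x y a) {s : ℕ → ℝ} (hs : ∀ n, 0 < s n) :
    switchPath (resettingPath x s) y = fun _ => 0 := by
  rcases le_or_gt y 0 with hy | hy
  · exact switchPath_eq_zero_of_nonpos hfh hε hx hy hs
  · refine switchPath_eq_zero_of_le fun t => not_lt.1 fun hlt => hcr ?_
    obtain ⟨a, ha, -, -, ha'⟩ := hx.exists_hitting hfh hε hy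
      (sub_nonneg.2 (lastReset_le (s := s) t.2)) (le_of_lt hlt)
    exact ⟨a, ha, ha'⟩

variable {Ω : Type*} [MeasurableSpace Ω] {P : Measure Ω} [IsProbabilityMeasure P]
  {σ : ℕ → Ω → ℝ}

theorem ae_switchPath_eq_altPath (hfh : IsResettingPair f h) (hε : 0 < ε)
    (hx : IsFlow f h ε x) (hσ : IsResetGaps h ε x P σ) {a : ℝ} (hcr : IsCrossing x y a) :
    ∀ᵐ ω ∂P, IsHoldingSeq (fun n => sojourn a n fun m => σ m ω) ∧
      switchPath (resettingPath x fun n => σ n ω) y =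
        altPath fun n => sojourn a n fun m => σ m ω := by
  filter_upwards [hσ.ae_frequently hcr.1] with ω hω
  exact ⟨isHoldingSeq_sojourn hcr.1 (hσ.pos · ω) hω, switchPath_resettingPath hcr.1 hcr.2
    (fun t ht => hx.eq_zero_iff hfh hε ht) (hσ.pos · ω) hω⟩

theorem isCadlag_zero : IsCadlag fun _ : ℝ≥0 => (0 : ℕ) :=
  fun _ => ⟨continuousWithinAt_const, 0, tendsto_const_nhds⟩

theorem ae_isCadlag_switchPath (hfh : IsResettingPair f h) (hε : 0 < ε)
    (hx : IsFlow f h ε x) (hσ : IsResetGaps h ε x P σ) (y : ℝ) :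
    ∀ᵐ ω ∂P, IsCadlag (switchPath (resettingPath x fun n => σ n ω) y) := by
  by_cases hcr : ∃ a, IsCrossing x y a
  · obtain ⟨a, ha⟩ := hcr
    filter_upwards [ae_switchPath_eq_altPath hfh hε hx hσ ha] with ω hω
    rw [hω.2]
    exact hω.1.isCadlag_altPath
  · refine Eventually.of_forall fun ω => ?_
    rw [switchPath_eq_zero_of_not_crossing hfh hε hx hcr (hσ.pos · ω)]
    exact isCadlag_zero

theorem aemeasurable_ofPath_switchPath (hfh : IsResettingPair f h) (hε : 0 < ε)
    (hx : IsFlow f h ε x) (hσ : IsResetGaps h ε x P σ) (y : ℝ) :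
    AEMeasurable (fun ω => SkorokhodSpace.ofPath (switchPath (resettingPath x fun n => σ n ω) y))
      P := by
  by_cases hcr : ∃ a, IsCrossing x y a
  · obtain ⟨a, ha⟩ := hcr
    have hae := ae_switchPath_eq_altPath hfh hε hx hσ ha
    refine (aemeasurable_ofPath_altPath (hσ.measurable_sojourn_seq a)
      (hae.mono fun ω hω => hω.1)).congr ?_
    filter_upwards [hae] with ω hω
    rw [hω.2]
  · simp only [switchPath_eq_zero_of_not_crossing hfh hε hx hcr (hσ.pos · _)]
    exact aemeasurable_const

end Hitting

/-! ### The limit process -/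

section Limit

variable {r₀ r₁ : ℝ} {Ω' : Type*} [MeasurableSpace Ω'] {P' : Measure Ω'} [IsProbabilityMeasure P']
  {S : ℕ → Ω' → ℝ}

theorem ae_isHoldingSeq_of_expMeasure (hr₀ : 0 < r₀) (hr₁ : 0 < r₁) (hS : ∀ n, Measurable (S n))
    (hind : iIndepFun S P') (hlaw : ∀ n, P'.map (S n) = expMeasure (if Even n then r₀ else r₁)) :
    ∀ᵐ ω ∂P', IsHoldingSeq fun n => S n ω := by
  have hr : ∀ n : ℕ, 0 < if Even n then r₀ else r₁ := fun n => by split_ifs <;> assumption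
  have hpos : ∀ᵐ ω ∂P', ∀ n, 0 < S n ω := ae_all_iff.2 fun n => by
    have := ae_expMeasure_pos (hr n)
    rw [← hlaw n] at this
    exact ae_of_ae_map (hS n).aemeasurable this
  -- The larger of the two rates gives a lower bound, common to all `n`, for the probability that a
  -- holding time exceeds `1`.
  have hfreq := ae_frequently_lt hS hind (a := 1)
    (p := ENNReal.ofReal (Real.exp (-max r₀ r₁ * 1))) (by simpa using Real.exp_pos _) fun n => by
      have := isProbabilityMeasure_expMeasure (hr n)
      have e : P' {ω | 1 < S n ω} = P'.map (S n) (Set.Ioi 1) :=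
        (Measure.map_apply (hS n) measurableSet_Ioi).symm
      rw [e, hlaw n, ← ofReal_measureReal, expMeasure_real_Ioi (hr n) zero_le_one]
      gcongr
      split_ifs
      exacts [le_max_left _ _, le_max_right _ _]
  filter_upwards [hpos, hfreq] with ω h1 h2
  exact isHoldingSeq_of_frequently h1 one_pos (h2.mono fun n hn => hn.le)

theorem charFun_of_expMeasure (hr₀ : 0 < r₀) (hr₁ : 0 < r₁) (hS : ∀ n, Measurable (S n))
    (hind : iIndepFun S P') (hlaw : ∀ n, P'.map (S n) = expMeasure (if Even n then r₀ else r₁))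
    (k : ℕ) (t : EuclideanSpace ℝ (Fin (2 * k))) :
    charFun (P'.map fun ω => WithLp.toLp 2 fun j : Fin (2 * k) => S j ω) t =
      ∏ j ∈ Finset.range (2 * k), expChar (if Even j then r₀ else r₁)
        (if hj : j < 2 * k then t ⟨j, hj⟩ else 0) := by
  have hr : ∀ n : ℕ, 0 < if Even n then r₀ else r₁ := fun n => by split_ifs <;> assumption
  have hi : iIndepFun (fun j : Fin (2 * k) => S j) P' := hind.precomp Fin.val_injective
  rw [(iIndepFun_iff_charFun_pi fun j : Fin (2 * k) => (hS j).aemeasurable).1 hi t,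
    Finset.prod_range]
  refine Finset.prod_congr rfl fun j _ => ?_
  rw [hlaw, charFun_expMeasure (hr j)]
  simp

end Limit

theorem eq_altPath_of_forall {S : ℕ → ℝ} (hS : IsHoldingSeq S) {X : ℝ≥0 → ℕ}
    (hX : ∀ (n : ℕ) (t : ℝ≥0), partialTime S n ≤ t → (t : ℝ) < partialTime S (n + 1) →
      X t = if Even n then 0 else 1) : X = altPath S := by
  ext t
  obtain ⟨n, hn, hn'⟩ := hS.exists_index (NNReal.coe_nonneg t)
  rw [hX n t hn hn', IsHoldingSeq.altPath_eq hS.1 hn hn']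

/-! ### Asymptotics of the gaps -/

theorem IsResettingPair.exists_bounds_near_one {f h : ℝ → ℝ} (hfh : IsResettingPair f h) {η : ℝ}
    (hη : 0 < η) : ∃ l < (1 : ℝ), ∀ u ∈ Set.Icc 0 1, l ≤ u →
      -(-f 1 + η) * u ≤ f u ∧ f u ≤ -(-f 1 - η) * u := by
  have hc : ContinuousWithinAt (fun u => f u - f 1 * u) (Set.Icc 0 1) 1 :=
    (hfh.contDiffOn_f.continuousOn.sub (by fun_prop)) 1 ⟨zero_le_one, le_rfl⟩
  have hlim : Tendsto (fun u => f u - f 1 * u) (𝓝[Set.Icc 0 1] 1) (𝓝 0) := by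
    have := hc.tendsto
    simpa using this
  have hev : ∀ᶠ u in 𝓝[Set.Icc 0 1] (1 : ℝ), |f u - f 1 * u| < η / 2 :=
    (tendsto_zero_iff_abs_tendsto_zero _).1 hlim |>.eventually_lt_const (by positivity)
  rw [eventually_nhdsWithin_iff, Metric.eventually_nhds_iff] at hev
  obtain ⟨δ, hδ, hev⟩ := hev
  -- The bound `u ≥ 1/2` turns the additive error `η / 2` into the multiplicative one `η * u`.
  refine ⟨max (1 - δ / 2) (1 / 2), max_lt (by linarith) (by norm_num), fun u hu hl => ?_⟩
  have h1 := (le_max_left _ _).trans hl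
  have h2 := (le_max_right _ _).trans hl
  have := abs_lt.1 (hev (y := u) (by rw [Real.dist_eq, abs_lt]; constructor <;> linarith [hu.2]) hu)
  constructor <;> nlinarith [this.1, this.2]

section Asymptotics

variable {f h : ℝ → ℝ} {ι : Type*} {l : Filter ι} {ε a : ι → ℝ} {x : ι → ℝ → ℝ}

/-- Dividing `abs_mul_survival_sub_le` by `G(a)` squeezes the integral between `x(a) / (f 0 + L M
a)` and `x(a) / (f 0 - L M a)`. -/
theorem tendsto_integral_survival_div (hfh : IsResettingPair f h) (hε : ∀ i, 0 < ε i)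
    (hx : ∀ i, IsFlow f h (ε i) (x i)) (ha : ∀ᶠ i in l, 0 < a i) (ha0 : Tendsto a l (𝓝 0))
    (hy : Tendsto (fun i => x i (a i)) l (𝓝 1)) :
    Tendsto (fun i => ∫ t in (0 : ℝ)..a i,
      survival h (ε i) (x i) t / survival h (ε i) (x i) (a i)) l (𝓝 (1 / f 0)) := by
  obtain ⟨L, hL, hLf⟩ := hfh.exists_abs_sub_le
  obtain ⟨M, hM, hMf⟩ := hfh.exists_abs_le
  have hf0 := hfh.f_zero_pos
  have hk : Tendsto (fun i => L * M * a i) l (𝓝 0) := by simpa using ha0.const_mul (L * M)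
  have hlow : Tendsto (fun i => x i (a i) / (f 0 + L * M * a i)) l (𝓝 (1 / f 0)) := by
    have := hy.div (hk.const_add (f 0)) (by simpa using hf0.ne')
    rw [add_zero] at this
    exact this
  have hupp : Tendsto (fun i => x i (a i) / (f 0 - L * M * a i)) l (𝓝 (1 / f 0)) := by
    have := hy.div (hk.const_sub (f 0)) (by simpa using hf0.ne')
    rw [sub_zero] at this
    exact this
  have key : ∀ᶠ i in l, |x i (a i) - f 0 * ∫ t in (0 : ℝ)..a i,
      survival h (ε i) (x i) t / survival h (ε i) (x i) (a i)| ≤ L * M * a i *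
        ∫ t in (0 : ℝ)..a i, survival h (ε i) (x i) t / survival h (ε i) (x i) (a i) := by
    filter_upwards [ha] with i hi
    have hp := survival_pos h (ε i) (x i) (a i)
    have := (hx i).abs_mul_survival_sub_le hfh (hε i) hL.le hLf hMf hi.le
    rw [intervalIntegral.integral_div]
    refine le_of_mul_le_mul_right ?_ hp
    rw [← abs_of_pos hp, ← abs_mul, abs_of_pos hp, sub_mul, mul_assoc (f 0),
      mul_assoc (L * M * a i), div_mul_cancel₀ _ hp.ne']
    exact this
  have hsmall : ∀ᶠ i in l, L * M * a i < f 0 := hk.eventually_lt_const hf0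
  refine tendsto_of_tendsto_of_tendsto_of_le_of_le' hlow hupp ?_ ?_
  · filter_upwards [key, ha] with i hi hai
    rw [div_le_iff₀ (by positivity)]
    linarith [(abs_le.1 hi).2]
  · filter_upwards [key, hsmall] with i hi hsi
    rw [le_div_iff₀ (by linarith)]
    linarith [(abs_le.1 hi).1]

theorem eventually_survival_bounds (hfh : IsResettingPair f h) (hε : ∀ i, 0 < ε i)
    (hx : ∀ i, IsFlow f h (ε i) (x i)) (ha : ∀ᶠ i in l, 0 < a i)
    (hy : Tendsto (fun i => x i (a i)) l (𝓝 1)) {η : ℝ} (hη : 0 < η) :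
    ∀ᶠ i in l, ∀ t, 0 ≤ t →
      x i (a i) * Real.exp (-(-f 1 + η) * t) ≤
        survival h (ε i) (x i) (a i + t) / survival h (ε i) (x i) (a i) ∧
      survival h (ε i) (x i) (a i + t) / survival h (ε i) (x i) (a i) ≤
        Real.exp (-(-f 1 - η) * t) := by
  obtain ⟨b, hb, hbf⟩ := hfh.exists_bounds_near_one hη
  filter_upwards [ha, hy.eventually_const_lt hb, hy.eventually_const_lt zero_lt_one]
    with i hai hbi h0i t ht
  exact (hx i).survival_bounds hfh (hε i) hai.le h0i
    (fun u hu => (hbf u ⟨h0i.le.trans hu.1, hu.2⟩ (hbi.le.trans hu.1)).1)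
    (fun u hu => (hbf u ⟨h0i.le.trans hu.1, hu.2⟩ (hbi.le.trans hu.1)).2) ht

theorem tendsto_survival_div (hfh : IsResettingPair f h) (hε : ∀ i, 0 < ε i)
    (hx : ∀ i, IsFlow f h (ε i) (x i)) (ha : ∀ᶠ i in l, 0 < a i)
    (hy : Tendsto (fun i => x i (a i)) l (𝓝 1)) {t : ℝ} (ht : 0 ≤ t) :
    Tendsto (fun i => survival h (ε i) (x i) (a i + t) / survival h (ε i) (x i) (a i)) l
      (𝓝 (Real.exp (-(-f 1) * t))) := by
  have hc1 : Tendsto (fun η => Real.exp (-(-f 1 + η) * t)) (𝓝[>] 0)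
      (𝓝 (Real.exp (-(-f 1) * t))) := by
    have : Continuous fun η => Real.exp (-(-f 1 + η) * t) := by fun_prop
    have := (this.tendsto 0).mono_left (nhdsWithin_le_nhds (s := Set.Ioi 0))
    rwa [add_zero] at this
  have hc2 : Tendsto (fun η => Real.exp (-(-f 1 - η) * t)) (𝓝[>] 0)
      (𝓝 (Real.exp (-(-f 1) * t))) := by
    have : Continuous fun η => Real.exp (-(-f 1 - η) * t) := by fun_prop
    have := (this.tendsto 0).mono_left (nhdsWithin_le_nhds (s := Set.Ioi 0))
    rwa [sub_zero] at this
  refine tendsto_order.2 ⟨fun b hb => ?_, fun b hb => ?_⟩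
  · obtain ⟨η, hηb, hη⟩ := ((hc1.eventually_const_lt hb).and self_mem_nhdsWithin).exists
    have hlim : Tendsto (fun i => x i (a i) * Real.exp (-(-f 1 + η) * t)) l
        (𝓝 (Real.exp (-(-f 1 + η) * t))) := by simpa using hy.mul_const _
    filter_upwards [eventually_survival_bounds hfh hε hx ha hy hη, hlim.eventually_const_lt hηb]
      with i h1 h2
    exact h2.trans_le (h1 t ht).1
  · obtain ⟨η, hηb, hη⟩ := ((hc2.eventually_lt_const hb).and self_mem_nhdsWithin).exists
    filter_upwards [eventually_survival_bounds hfh hε hx ha hy hη] with i h1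
    exact (h1 t ht).2.trans_lt hηb

end Asymptotics

/-! ### Crossing times of the level `1 - ε ^ β` -/

theorem tendsto_one_sub_rpow {β : ℝ} (hβ : 0 < β) :
    Tendsto (fun ε : ℝ => 1 - ε ^ β) (𝓝[>] 0) (𝓝 1) := by
  have := ((Real.continuousAt_rpow_const 0 β (Or.inr hβ.le)).tendsto.mono_left
    (nhdsWithin_le_nhds (s := Set.Ioi 0))).const_sub 1
  rwa [Real.zero_rpow hβ.ne', sub_zero] at this

theorem IsResettingPair.exists_crossing_times {f h : ℝ → ℝ} (hfh : IsResettingPair f h) {β : ℝ}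
    (hβ : β ∈ Set.Ioo (0 : ℝ) (1 / 2)) {x : Set.Ioi (0 : ℝ) → ℝ → ℝ}
    (hx : ∀ ε : Set.Ioi (0 : ℝ), IsFlow f h ε (x ε)) :
    ∃ a : Set.Ioi (0 : ℝ) → ℝ, Tendsto a (comap Subtype.val (𝓝[>] (0 : ℝ))) (𝓝 0) ∧
      ∀ᶠ ε in comap Subtype.val (𝓝[>] (0 : ℝ)), IsCrossing (x ε) (1 - (ε : ℝ) ^ β) (a ε) ∧
        x ε (a ε) = 1 - (ε : ℝ) ^ β := by
  obtain ⟨C, hC⟩ := hfh.exists_hitting_le hβ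
  have hpos : ∀ᶠ ε : ℝ in 𝓝[>] 0, 0 < 1 - ε ^ β :=
    (tendsto_one_sub_rpow hβ.1).eventually_const_lt zero_lt_one
  -- A function of every `ε` is wanted, but a crossing is only guaranteed for small `ε`; elsewhere
  -- the default `0` is chosen.
  have hex : ∀ ε : Set.Ioi (0 : ℝ), ∃ a, (0 < 1 - (ε : ℝ) ^ β ∧ 0 ≤ C * √(ε : ℝ) ∧
      1 - (ε : ℝ) ^ β ≤ x ε (C * √(ε : ℝ))) → (0 < a ∧ a ≤ C * √(ε : ℝ) ∧
      x ε a = 1 - (ε : ℝ) ^ β ∧ ∀ t, 0 ≤ t → (1 - (ε : ℝ) ^ β < x ε t ↔ a < t)) := fun ε => by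
    by_cases hgood : 0 < 1 - (ε : ℝ) ^ β ∧ 0 ≤ C * √(ε : ℝ) ∧
      1 - (ε : ℝ) ^ β ≤ x ε (C * √(ε : ℝ))
    · obtain ⟨a, ha⟩ := (hx ε).exists_hitting hfh ε.2 hgood.1 hgood.2.1 hgood.2.2
      exact ⟨a, fun _ => ha⟩
    · exact ⟨0, fun hg => absurd hg hgood⟩
  choose a ha using hex
  have hgood : ∀ᶠ ε : Set.Ioi (0 : ℝ) in comap Subtype.val (𝓝[>] (0 : ℝ)),
      0 < 1 - (ε : ℝ) ^ β ∧ 0 ≤ C * √(ε : ℝ) ∧ 1 - (ε : ℝ) ^ β ≤ x ε (C * √(ε : ℝ)) := by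
    filter_upwards [tendsto_comap.eventually hpos, tendsto_comap.eventually hC] with ε h1 h2
    exact ⟨h1, h2 _ (hx ε)⟩
  refine ⟨a, ?_, ?_⟩
  · have hsq : Tendsto (fun ε : Set.Ioi (0 : ℝ) => C * √(ε : ℝ))
        (comap Subtype.val (𝓝[>] (0 : ℝ))) (𝓝 0) := by
      have h1 := (Real.continuous_sqrt.tendsto 0).mono_left (nhdsWithin_le_nhds (s := Set.Ioi 0))
      have h2 := (h1.const_mul C).comp (tendsto_comap (f := (Subtype.val : Set.Ioi (0 : ℝ) → ℝ)))
      rwa [Real.sqrt_zero, mul_zero] at h2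
    refine squeeze_zero' ?_ ?_ hsq
    · filter_upwards [hgood] with ε hε using (ha ε hε).1.le
    · filter_upwards [hgood] with ε hε using (ha ε hε).2.1
  · filter_upwards [hgood] with ε hε
    obtain ⟨h1, -, h3, h4⟩ := ha ε hε
    exact ⟨⟨h1, h4⟩, h3⟩

/-! ### Convergence of the sojourns and of the switching path -/

theorem tendstoInDistribution_sojourn
    {f h : ℝ → ℝ} (hfh : IsResettingPair f h) {ι : Type*} {l : Filter ι} [l.IsCountablyGenerated]
    {ε a : ι → ℝ} {x : ι → ℝ → ℝ} (hε : ∀ i, 0 < ε i) (hx : ∀ i, IsFlow f h (ε i) (x i))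
    {Ω : ι → Type*} [∀ i, MeasurableSpace (Ω i)]
    {P : (i : ι) → Measure (Ω i)} [∀ i, IsProbabilityMeasure (P i)]
    {σ : (i : ι) → ℕ → Ω i → ℝ} (hσ : ∀ i, IsResetGaps h (ε i) (x i) (P i) (σ i))
    (ha : ∀ᶠ i in l, 0 < a i) (ha0 : Tendsto a l (𝓝 0))
    (hy : Tendsto (fun i => x i (a i)) l (𝓝 1))
    {Ω' : Type*} [MeasurableSpace Ω'] {P' : Measure Ω'} [IsProbabilityMeasure P']
    {S : ℕ → Ω' → ℝ} (hS : ∀ n, Measurable (S n)) (hind : iIndepFun S P')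
    (hlaw : ∀ n, P'.map (S n) = expMeasure (if Even n then f 0 else -f 1)) :
    TendstoInDistribution (fun i ω n => sojourn (a i) n fun m => σ i m ω) l
      (fun ω n => S n ω) P P' := by
  have hf0 := hfh.f_zero_pos
  have hf1 : 0 < -f 1 := neg_pos.2 hfh.f_one_neg
  have hprob : ∀ i, IsProbabilityMeasure ((P i).map (σ i 0)) := fun i =>
    Measure.isProbabilityMeasure_map ((hσ i).measurable 0).aemeasurable
  refine tendstoInDistribution_of_tendsto_charFun (fun i => (hσ i).measurable_sojourn_seq (a i))
    (measurable_pi_lambda _ hS) fun k t => ?_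
  rw [charFun_of_expMeasure hf0 hf1 hS hind hlaw]
  simp only [(hσ _).charFun_sojourn]
  -- Half of the limiting rate `-f 1` serves for the domination: it is the bound of
  -- `eventually_survival_bounds` with `η = -f 1 / 2`.
  refine tendsto_sojournChar (c := -f 1 / 2) hf1 (by positivity) (fun i => (hσ i).ae_map_pos)
    ha ha0 ?_ ?_ ?_ ?_ k _
  · filter_upwards [ha] with i hi
    rw [(hσ i).map_real_Ioi 0 hi.le]
    exact survival_pos ..
  · refine (tendsto_integral_survival_div hfh hε hx ha ha0 hy).congr' ?_
    filter_upwards [ha] with i hi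
    refine intervalIntegral.integral_congr fun t ht => ?_
    rw [Set.uIcc_of_le hi.le] at ht
    simp only [(hσ i).map_real_Ioi 0 hi.le, (hσ i).map_real_Ioi 0 ht.1]
  · intro t ht
    refine (tendsto_survival_div hfh hε hx ha hy ht.le).congr' ?_
    filter_upwards [ha] with i hi
    rw [(hσ i).map_real_Ioi 0 hi.le, (hσ i).map_real_Ioi 0 (by linarith)]
  · filter_upwards [ha, eventually_survival_bounds hfh hε hx ha hy (half_pos hf1)] with i hi hb t ht
    rw [(hσ i).map_real_Ioi 0 hi.le, (hσ i).map_real_Ioi 0 (by linarith)]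
    refine (hb t ht.le).2.trans (le_of_eq ?_)
    ring_nf

theorem proposition3p1
    (f h : ℝ → ℝ) (hfh : IsResettingPair f h)
    (β : ℝ) (hβ : β ∈ Set.Ioo (0 : ℝ) (1 / 2))
    -- the flow and the gaps between the resets, for each parameter `ε > 0`
    (x : Set.Ioi (0 : ℝ) → ℝ → ℝ) (hx : ∀ ε : Set.Ioi (0 : ℝ), IsFlow f h ε (x ε))
    {Ω : Set.Ioi (0 : ℝ) → Type*} [∀ ε, MeasurableSpace (Ω ε)]
    (P : (ε : Set.Ioi (0 : ℝ)) → Measure (Ω ε)) [∀ ε, IsProbabilityMeasure (P ε)]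
    (σ : (ε : Set.Ioi (0 : ℝ)) → ℕ → Ω ε → ℝ)
    (hσ : ∀ ε : Set.Ioi (0 : ℝ), IsResetGaps h ε (x ε) (P ε) (σ ε))
    -- the process of the jumps, at the level `1 - ε ^ β`
    (Xbar : (ε : Set.Ioi (0 : ℝ)) → Ω ε → ℝ≥0 → ℕ)
    (hXbar : ∀ (ε : Set.Ioi (0 : ℝ)) (ω : Ω ε), Xbar ε ω =
      switchPath (resettingPath (x ε) (fun n => σ ε n ω)) (1 - (ε : ℝ) ^ β))
    -- the limit
    {Ω' : Type*} [MeasurableSpace Ω'] (P' : Measure Ω') [IsProbabilityMeasure P']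
    (Xlim : Ω' → ℝ≥0 → ℕ) (hXlim : IsTwoStateJumpMarkov (f 0) (-f 1) P' Xlim) :
    (∀ (ε : Set.Ioi (0 : ℝ)) (ω : Ω ε) (t : ℝ≥0), Xbar ε ω t = 0 ∨ Xbar ε ω t = 1) ∧
    (∀ ε : Set.Ioi (0 : ℝ), ∀ᵐ ω ∂(P ε), IsCadlag (Xbar ε ω)) ∧
    (∀ᵐ ω ∂P', IsCadlag (Xlim ω)) ∧
    TendstoInDistribution (fun (ε : Set.Ioi (0 : ℝ)) ω => SkorokhodSpace.ofPath (Xbar ε ω))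
      (comap Subtype.val (𝓝[>] (0 : ℝ)))
      (fun ω => SkorokhodSpace.ofPath (Xlim ω)) P P' := by
  obtain ⟨S, hS, hind, hlaw, hXS⟩ := hXlim
  have hf0 := hfh.f_zero_pos
  have hf1 : 0 < -f 1 := neg_pos.2 hfh.f_one_neg
  have hhold := ae_isHoldingSeq_of_expMeasure hf0 hf1 hS hind hlaw
  have hlim : ∀ᵐ ω ∂P', IsHoldingSeq (fun n => S n ω) ∧ Xlim ω = altPath fun n => S n ω := by
    filter_upwards [hhold, hXS] with ω h1 h2
    exact ⟨h1, eq_altPath_of_forall h1 h2⟩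
  refine ⟨fun ε ω t => ?_, fun ε => ?_, ?_, ?_⟩
  · rw [hXbar]
    exact switchPath_eq_zero_or_one _ _ _
  · simp only [hXbar]
    exact ae_isCadlag_switchPath hfh ε.2 (hx ε) (hσ ε) _
  · filter_upwards [hlim] with ω hω
    rw [hω.2]
    exact hω.1.isCadlag_altPath
  · obtain ⟨a, ha0, ha⟩ := hfh.exists_crossing_times hβ hx
    have hy : Tendsto (fun ε : Set.Ioi (0 : ℝ) => x ε (a ε)) (comap Subtype.val (𝓝[>] (0 : ℝ)))
        (𝓝 1) := by
      refine ((tendsto_one_sub_rpow hβ.1).comp tendsto_comap).congr' ?_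
      filter_upwards [ha] with ε hε using hε.2.symm
    have hD := tendstoInDistribution_sojourn (ε := fun ε : Set.Ioi (0 : ℝ) => (ε : ℝ)) hfh
      (fun ε => ε.2) hx hσ (ha.mono fun ε hε => hε.1.1) ha0 hy hS hind hlaw
    -- Measurability is needed for every `ε`, including those without a crossing, while the
    -- representation by sojourns is only needed for small `ε`.
    refine TendstoInDistribution.continuousOn_comp continuousOn_ofPath_altPath hD
      (fun ε => ?_) ?_ ?_ ?_
    · simp only [hXbar]
      exact aemeasurable_ofPath_switchPath hfh ε.2 (hx ε) (hσ ε) _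
    · refine (aemeasurable_ofPath_altPath (measurable_pi_lambda _ hS) hhold).congr ?_
      filter_upwards [hlim] with ω hω
      rw [hω.2]
    · filter_upwards [ha] with ε hε
      filter_upwards [ae_switchPath_eq_altPath hfh ε.2 (hx ε) (hσ ε) hε.1] with ω hω
      exact ⟨hω.1, by rw [hXbar, hω.2]⟩
    · filter_upwards [hlim] with ω hω
      exact ⟨hω.1, by rw [hω.2]⟩
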